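/- **Setting.** Let $G$ be a finite bipartite graph with bipartition $(L,R)$, $n=|L|+|R|$ vertices, neighborhoods $N_w$, and capacities $C_v\in\mathbb N$ for $v\in R$. A *fractional allocation* assigns to each edge $(u,v)$ ($u\in L$, $v\in R$) a number $x_{u,v}\in[0,1]$ such that $\sum_{v\in N_u}x_{u,v}\le 1$ for all $u\in L$ and $\sum_{u\in N_v}x_{u,v}\le C_v$ for all $v\in R$; its *weight* is the sum of $x_{u,v}$ over all edges. It is *$a$-approximate* if the maximum weight of a fractional allocation is at most $a$ times its weight. **Algorithm.** Parameters: $\varepsilon>0$, a number $\tau\ge1$ of rounds, a phase length $B\in\mathbb N_{\ge1}$, and $t=\lceil(1+\varepsilon)^{2B}\varepsilon^{-5}\log n\rceil$ ($\log$ is the natural logarithm). Start with $\beta_v=1$ for $v\in R$ and $\beta_u=|N_u|$ for $u\in L$. The rounds $1,\dots,\tau$ are divided into consecutive phases of $B$ rounds (the last one may be shorter). * At the beginning of a phase, for every vertex $w$, partition $N_w$ into the groups $\mathcal L_{w,x}=\{a\in N_w:\beta_a\in((1+\varepsilon)^{x-1},(1+\varepsilon)^x]\}$, $x=-2\tau,\dots,2\tau$.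 They stay fixed during the phase. * In each round, for every vertex $w$ and every $x$ with $\mathcal L_{w,x}\ne\emptyset$, draw $t$ fresh independent uniformly random elements $y_{w,x,1},\dots,y_{w,x,t}$ of $\mathcal L_{w,x}$ (all draws of the round are independent). For a function $f$ on vertices, estimate $\sum_{a\in N_w}f(a)$ by $\mathrm{Est}_w(f)=\sum_{x:\,\mathcal L_{w,x}\neq\emptyset}\frac{|\mathcal L_{w,x}|}{t}\sum_{i=1}^t f(y_{w,x,i})$. First, every $u\in L$ sets $\beta_u\leftarrow\mathrm{Est}_u(a\mapsto\beta_a)$. Then every $v\in R$ computes $\overline{\mathrm{alloc}}_v=\mathrm{Est}_v(u\mapsto\beta_v/\beta_u)$ and, all simultaneously, each $\beta_v$ is multiplied by $1+\varepsilon$ if $\overline{\mathrm{alloc}}_v\le C_v/(1+\varepsilon)$, divided by $1+\varepsilon$ if $\overline{\mathrm{alloc}}_v\ge C_v(1+\varepsilon)$, and left unchanged otherwise. * Output: with the values $\beta_v$, $v\in R$, held at the beginning of round $\tau$, let $x_{u,v}=\beta_v/\sum_{v'\in N_u}\beta_{v'}$ and $\mathrm{alloc}_v=\sum_{u\in N_v}x_{u,v}$;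 output $x'_{u,v}=\min(1,C_v/\mathrm{alloc}_v)\,x_{u,v}$ for every edge $(u,v)$. **Theorem.** Let $0<\varepsilon\le\frac14$, $B\ge1$, and $\tau\ge\tau_0:=\frac{2\log(2|R|/\varepsilon)}{\varepsilon^2}+\frac1\varepsilon$ (with the convention $\log 0=0$ if $R=\emptyset$). Then, on every finite bipartite graph with any capacities, the output of the algorithm is a $(1+18\varepsilon)$-approximate fractional allocation with high probability, namely with probability at least $1-\frac{\tau}{\tau_0}\,n^{-10}$ (for $n=0$, with probability $1$). In particular the failure probability is at most $n^{-5}$ whenever $n\ge1$ and $\tau\le n^5\tau_0$. -/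

import Mathlib

open scoped Classical

noncomputable section

/-- An instance of the allocation problem: a bipartite graph with a given bipartition `(L, R)` of its
whole vertex set, and capacities (only the values of `C` on `R` are ever used). -/
structure AllocationInstance (V : Type*) where
  graph : SimpleGraph V
  L : Finset V
  R : Finset V
  bipartite : graph.IsBipartiteWith (L : Set V) (R : Set V)
  cover : ∀ w, w ∈ L ∨ w ∈ R
  C : V → ℕ

namespace AllocationInstance

variable {V : Type*} [Fintype V] (I : AllocationInstance V)

/-- The neighborhood of `w`. -/
def N (w : V) : Finset V := Finset.univ.filter fun a => I.graph.Adj w a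

/-- `x u v` is the fraction of the edge between `u ∈ L` and `v ∈ R`; other values are irrelevant. -/
def IsFractionalAllocation (x : V → V → ℝ) : Prop :=
  (∀ u ∈ I.L, ∀ v ∈ I.N u, 0 ≤ x u v ∧ x u v ≤ 1) ∧
  (∀ u ∈ I.L, ∑ v ∈ I.N u, x u v ≤ 1) ∧
  (∀ v ∈ I.R, ∑ u ∈ I.N v, x u v ≤ I.C v)

/-- The sum of the fractions of all edges. -/
def weight (x : V → V → ℝ) : ℝ := ∑ u ∈ I.L, ∑ v ∈ I.N u, x u v

/-- `x` is a fractional allocation, and the maximum weight of a fractional allocation is at most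
`a` times the weight of `x`. -/
def IsApproxFractionalAllocation (a : ℝ) (x : V → V → ℝ) : Prop :=
  I.IsFractionalAllocation x ∧ ∀ y, I.IsFractionalAllocation y → I.weight y ≤ a * I.weight x

/-! Exact quantities determined by the priorities `β v`, `v ∈ R`. -/

/-- The proportional fraction `x_{u,v} = β_v / ∑_{v' ∈ N_u} β_{v'}`. -/
def proportional (β : V → ℝ) (u v : V) : ℝ := β v / ∑ v' ∈ I.N u, β v'

/-- `alloc_v = ∑_{u ∈ N_v} x_{u,v}`. -/
def alloc (β : V → ℝ) (v : V) : ℝ := ∑ u ∈ I.N v, I.proportional β u v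

/-- `min(1, C_v / alloc_v) * x_{u,v}`. -/
def rescaled (β : V → ℝ) (u v : V) : ℝ :=
  min 1 ((I.C v : ℝ) / I.alloc β v) * I.proportional β u v

/-! The sampling-based algorithm. -/

/-- The indices `-2τ, …, 2τ` of the groups. -/
abbrev Level (τ : ℕ) : Type := ↥(Finset.Icc (-(2 * (τ : ℤ))) (2 * (τ : ℤ)))

/-- The neighbors `a` of `w` with `β_a ∈ ((1+ε)^(x-1), (1+ε)^x]`. -/
def group (ε : ℝ) (β : V → ℝ) (w : V) (x : ℤ) : Finset V :=
  (I.N w).filter fun a => (1 + ε) ^ (x - 1) < β a ∧ β a ≤ (1 + ε) ^ x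

/-- The set from which the samples of the group `x` of `w` are drawn: the group itself. (For an empty
group it is an arbitrary singleton, whose element is never used: see `estimate`.) -/
def sampleSet (ε : ℝ) (β : V → ℝ) (w : V) (x : ℤ) : Finset V :=
  if (I.group ε β w x).Nonempty then I.group ε β w x else {w}

theorem sampleSet_nonempty (ε : ℝ) (β : V → ℝ) (w : V) (x : ℤ) :
    (I.sampleSet ε β w x).Nonempty := by
  unfold sampleSet
  split_ifs with h
  · exact h
  · exact Finset.singleton_nonempty w

/-- The number `t = (1+ε)^(2B) ε^(-5) log n` of samples per group, rounded up. -/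
def numSamples (V : Type*) [Fintype V] (ε : ℝ) (B : ℕ) : ℕ :=
  ⌈(1 + ε) ^ (2 * B) * (ε ^ 5)⁻¹ * Real.log (Fintype.card V)⌉₊

/-- All the samples of one round: `t` vertices for every vertex and every group of neighbors. -/
abbrev Samples (V : Type*) (τ t : ℕ) : Type _ := V × Level τ × Fin t → V

/-- The samples are uniform in their groups, and all independent (a uniformly random element of a
finite product of finite sets). The groups are those of the priorities `β`. -/
def drawSamples (ε : ℝ) (τ t : ℕ) (β : V → ℝ) : PMF (Samples V τ t) :=
  PMF.uniformOfFinset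
    (Fintype.piFinset fun k : V × Level τ × Fin t => I.sampleSet ε β k.1 k.2.1)
    (Fintype.piFinset_nonempty.2 fun k => I.sampleSet_nonempty ε β k.1 k.2.1)

/-- The estimate of `∑ a ∈ N_w, f a`: the sum over all groups of
`(size of the group / t) * (sum of f over the t samples of the group)`. -/
def estimate (ε : ℝ) (τ t : ℕ) (β : V → ℝ) (s : Samples V τ t) (w : V) (f : V → ℝ) : ℝ :=
  ∑ x : Level τ, ((I.group ε β w x).card : ℝ) / t * ∑ i : Fin t, f (s (w, x, i))

/-- The memory of the algorithm: the priorities at the beginning of the current phase (they determine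
the groups), the current priorities, and the fractional allocation computed in the last round. -/
structure State (V : Type*) where
  phaseStart : V → ℝ
  β : V → ℝ
  out : V → V → ℝ

/-- Initially `β_v = 1` for `v ∈ R` and `β_u = ∑_{v ∈ N_u} 1` for `u ∈ L`. -/
def initPriority (w : V) : ℝ := if w ∈ I.L then ((I.N w).card : ℝ) else 1

def initState : State V := ⟨I.initPriority, I.initPriority, fun _ _ => 0⟩

/-- The new `β_v` of `v ∈ R`, from the old one and the estimate of `alloc_v`. -/
def updatePriority (ε c a b : ℝ) : ℝ :=
  if a ≤ c / (1 + ε) then b * (1 + ε) else if c * (1 + ε) ≤ a then b / (1 + ε) else b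

/-- The deterministic part of a round: `g` are the priorities that determine the groups, `β` the
current priorities and `s` the samples. The new `β_u`, `u ∈ L`, are computed first and are used in the
estimates of `alloc_v = ∑_{u ∈ N_v} β_v / β_u`, `v ∈ R`. -/
def newPriority (ε : ℝ) (τ t : ℕ) (g β : V → ℝ) (s : Samples V τ t) (w : V) : ℝ :=
  let βL : V → ℝ := fun u => I.estimate ε τ t g s u β
  if w ∈ I.L then βL w
  else updatePriority ε (I.C w) (I.estimate ε τ t g s w fun u => β w / βL u) (β w)

/-- Round number `r + 1`. A new phase begins every `B` rounds, and fresh samples are drawn in every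
round from the groups that were fixed at the beginning of the phase. -/
def round (ε : ℝ) (B τ t r : ℕ) (S : State V) : PMF (State V) :=
  let g : V → ℝ := if r % B = 0 then S.β else S.phaseStart
  (I.drawSamples ε τ t g).map fun s => ⟨g, I.newPriority ε τ t g S.β s, I.rescaled S.β⟩

/-- The state after the first `r` rounds. -/
def run (ε : ℝ) (B τ t : ℕ) : ℕ → PMF (State V)
  | 0 => PMF.pure I.initState
  | r + 1 => (run ε B τ t r).bind (I.round ε B τ t r)

/-- The random output of the algorithm executed for `τ` rounds, in phases of `B` rounds. -/
def sampledAllocation (ε : ℝ) (B τ : ℕ) : PMF (V → V → ℝ) :=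
  (I.run ε B τ (numSamples V ε B) τ).map State.out

/-- `2 log(2|R|/ε)/ε² + 1/ε`. -/
def roundBound (ε : ℝ) : ℝ := 2 * Real.log (2 * (I.R.card : ℝ) / ε) / ε ^ 2 + 1 / ε

end AllocationInstance

end

/-!
The proof separates a deterministic statement about one accurate round from the probability that a
round is accurate. Write `δ = 3ε/2` and call a round accurate if every estimate made in it has a
relative error of at most `δ`. The value of `δ` is a compromise, which matters for `ε` close to `1/4`: a
much larger one spoils the ratio `1 + 18ε`, a much smaller one the failure probability.

*Deterministic part.* The priorities of the right vertices are powers of `1 + ε`; the exponent is the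
level of the vertex. If the priority of `v` is raised, its allocation does not drop, because the sums in
the denominators grow by at most the same factor. So a vertex that is not on the highest possible level
was estimated to be nearly full the last time it was not raised, and it has remained nearly full
(up to the factor `slack ε δ`); symmetrically, a vertex that is not on the lowest possible level is not
much overfull. This is the invariant `Balanced`, preserved by accurate rounds
(`Balanced.newPriority`). For balanced priorities, `Balanced.isApprox` compares with the bound
"capacities of the vertices up to level `j`, plus the number of left vertices with a neighbor above `j`"
for the weight of a fractional allocation. The capacities are paid for by the output on the levels up to
`j`. A left vertex with a neighbor above `j` sends almost everything to the levels above `j - m`, where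
`(1 + ε) ^ m` dwarfs `|R|`, so the left vertices are paid for by the output on those levels. Only the
window `(j - m, j]` is used twice, and among `⌈1/ε⌉` disjoint windows one carries at most the fraction
`ε` of the output; the lower bound on `τ` makes room for these windows.

*Probabilistic part.* On each group the function whose sum is estimated varies by at most the factor
`groupSpread`, about `(1 + ε) ^ (2B)`: the groups of a left vertex are homogeneous at the beginning of
the phase, so its estimates stay in a fixed range whatever the samples are
(`Grouping.estimate_mem_Icc`), and the priorities of the left vertices that define the groups were
calibrated by the last accurate round of the preceding phase. A Chernoff bound for uniform elements of a
finite product, proved by summing exponentials over the product (`chernoff_upper`, `chernoff_lower`),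
then shows that an estimate fails with probability at most `2 exp (-log n / (3ε³))`. The function estimated
at a right vertex depends on the samples of the left vertices only, and conditioning on these is done by
exchanging coordinates between two sample points (`card_filter_piFinset_le_of_resample`). A union bound
over the vertices and the first `τ - 1` rounds finishes the proof (`run_toOuterMeasure_le`,
`round_failure_le`).
-/

/-! ### Chernoff bounds for uniform elements of a finite product -/

section Chernoff

open Finset

variable {ι α : Type*} [Fintype ι] [DecidableEq ι]

theorem exp_mul_le_of_mem_Icc {A z : ℝ} (hA : 0 < A) (hz : 0 ≤ z) (hzA : z ≤ A) (θ : ℝ) :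
    Real.exp (θ * z) ≤ 1 + z / A * (Real.exp (θ * A) - 1) := by
  have h := convexOn_exp.2 (Set.mem_univ 0) (Set.mem_univ (θ * A))
    (show 0 ≤ 1 - z / A by rw [sub_nonneg, div_le_one hA]; exact hzA)
    (show 0 ≤ z / A by positivity) (by ring)
  have e : (1 - z / A) • (0 : ℝ) + (z / A) • (θ * A) = θ * z := by
    simp only [smul_eq_mul]; field_simp; ring
  rw [e] at h
  simp only [smul_eq_mul, Real.exp_zero] at h
  linarith

/-- The moment generating function of a sum of independent variables `Z k (s k)` with values in
`[0, A]` and total mean `μ` is at most that of a Poisson variable, scaled by `A`. -/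
theorem sum_piFinset_exp_le (T : ι → Finset α) (Z : ι → α → ℝ) {A : ℝ} (hA : 0 < A)
    (hZ : ∀ k, ∀ a ∈ T k, 0 ≤ Z k a ∧ Z k a ≤ A) (θ : ℝ) :
    ∑ s ∈ Fintype.piFinset T, Real.exp (θ * ∑ k, Z k (s k)) ≤
      (#(Fintype.piFinset T) : ℝ) *
        Real.exp ((∑ k, (∑ a ∈ T k, Z k a) / #(T k)) / A * (Real.exp (θ * A) - 1)) := by
  have h1 : ∀ s : ι → α, Real.exp (θ * ∑ k, Z k (s k)) = ∏ k, Real.exp (θ * Z k (s k)) := by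
    intro s; rw [mul_sum, Real.exp_sum]
  simp only [h1]
  rw [← prod_univ_sum T (fun k a => Real.exp (θ * Z k a)), Fintype.card_piFinset, sum_div, sum_mul,
    Real.exp_sum, Nat.cast_prod, ← prod_mul_distrib]
  refine prod_le_prod (fun k _ => sum_nonneg fun a _ => (Real.exp_pos _).le) fun k _ => ?_
  rcases (T k).eq_empty_or_nonempty with h | h
  · simp [h]
  have hc : (0 : ℝ) < #(T k) := by exact_mod_cast h.card_pos
  calc ∑ a ∈ T k, Real.exp (θ * Z k a)
      ≤ ∑ a ∈ T k, (1 + Z k a / A * (Real.exp (θ * A) - 1)) :=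
        sum_le_sum fun a ha => exp_mul_le_of_mem_Icc hA (hZ k a ha).1 (hZ k a ha).2 θ
    _ = #(T k) * ((∑ a ∈ T k, Z k a) / #(T k) / A * (Real.exp (θ * A) - 1) + 1) := by
        rw [sum_add_distrib, ← sum_mul, ← sum_div]
        simp only [sum_const, nsmul_eq_mul, mul_one]
        field_simp
        ring
    _ ≤ _ := by
        gcongr
        exact Real.add_one_le_exp _

theorem card_filter_le_of_sum_exp {S : Finset α} {X : α → ℝ} {c D E : ℝ}
    (h : ∑ s ∈ S, Real.exp (X s) ≤ (#S : ℝ) * Real.exp E) (hD : E - c ≤ -D) :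
    (#(S.filter fun s => c ≤ X s) : ℝ) ≤ Real.exp (-D) * #S := by
  have h1 : (#(S.filter fun s => c ≤ X s) : ℝ) * Real.exp c ≤ ∑ s ∈ S, Real.exp (X s) := by
    calc (#(S.filter fun s => c ≤ X s) : ℝ) * Real.exp c
        = ∑ s ∈ S.filter fun s => c ≤ X s, Real.exp c := by simp
      _ ≤ ∑ s ∈ S.filter fun s => c ≤ X s, Real.exp (X s) :=
        sum_le_sum fun s hs => Real.exp_le_exp.2 (mem_filter.1 hs).2
      _ ≤ _ := sum_le_sum_of_subset_of_nonneg (filter_subset _ _) fun _ _ _ => (Real.exp_pos _).le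
  have h2 : (#(S.filter fun s => c ≤ X s) : ℝ) ≤ #S * Real.exp (E - c) := by
    rw [Real.exp_sub, ← mul_div_assoc, le_div_iff₀ (Real.exp_pos c)]
    exact h1.trans h
  rw [mul_comm]
  exact h2.trans (by gcongr)

theorem exp_neg_le_quadratic {x : ℝ} (hx : 0 ≤ x) : Real.exp (-x) ≤ 1 - x + x ^ 2 / 2 := by
  have h := Real.quadratic_le_exp_of_nonneg hx
  rw [Real.exp_neg, inv_le_iff_one_le_mul₀ (Real.exp_pos x)]
  have h0 : 0 ≤ 1 - x + x ^ 2 / 2 := by nlinarith [sq_nonneg (x - 1)]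
  nlinarith [mul_le_mul_of_nonneg_left h h0, sq_nonneg (x ^ 2)]

variable (T : ι → Finset α) (Z : ι → α → ℝ) {A μ δ : ℝ}

theorem chernoff_upper (hA : 0 < A) (hZ : ∀ k, ∀ a ∈ T k, 0 ≤ Z k a ∧ Z k a ≤ A)
    (hμ : ∑ k, (∑ a ∈ T k, Z k a) / #(T k) = μ) (hμ0 : 0 ≤ μ) (hδ : 0 ≤ δ) :
    (#((Fintype.piFinset T).filter fun s => (1 + δ) * μ ≤ ∑ k, Z k (s k)) : ℝ) ≤
      Real.exp (-(μ / A * (δ ^ 2 / (2 + δ)))) * #(Fintype.piFinset T) := by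
  -- The optimal exponent `θ / A` has `θ = log (1 + δ)`.
  set θ := Real.log (1 + δ)
  have hθ : 2 * δ / (δ + 2) ≤ θ := Real.le_log_one_add_of_nonneg hδ
  have hθ0 : 0 ≤ θ := Real.log_nonneg (by linarith)
  have h := sum_piFinset_exp_le T Z hA hZ (θ / A)
  rw [hμ, div_mul_cancel₀ _ hA.ne', Real.exp_log (by linarith)] at h
  rcases hθ0.eq_or_lt with h0 | h0
  · have hδ0 : δ = 0 := by
      have : 1 + δ = 1 := by
        rw [← Real.exp_log (show 0 < 1 + δ by linarith), show Real.log (1 + δ) = 0 from h0.symm,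
          Real.exp_zero]
      linarith
    subst hδ0
    simp only [ne_eq, OfNat.ofNat_ne_zero, not_false_eq_true, zero_pow, zero_div, mul_zero,
      neg_zero, Real.exp_zero, one_mul]
    exact_mod_cast card_filter_le _ _
  · refine (Nat.cast_le.2 (card_le_card ?_)).trans (card_filter_le_of_sum_exp
      (c := θ / A * ((1 + δ) * μ)) h ?_)
    · intro s hs
      rw [mem_filter] at hs ⊢
      exact ⟨hs.1, by gcongr; exact hs.2⟩
    · have e : μ / A * (1 + δ - 1) - θ / A * ((1 + δ) * μ) = -(μ / A * ((1 + δ) * θ - δ)) := by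
        field_simp; ring
      rw [e]
      gcongr
      have : (1 + δ) * (2 * δ / (δ + 2)) - δ = δ ^ 2 / (2 + δ) := by
        field_simp; ring
      rw [← this]
      gcongr

theorem chernoff_lower (hA : 0 < A) (hZ : ∀ k, ∀ a ∈ T k, 0 ≤ Z k a ∧ Z k a ≤ A)
    (hμ : ∑ k, (∑ a ∈ T k, Z k a) / #(T k) = μ) (hμ0 : 0 ≤ μ) (hδ : 0 ≤ δ) :
    (#((Fintype.piFinset T).filter fun s => ∑ k, Z k (s k) ≤ (1 - δ) * μ) : ℝ) ≤
      Real.exp (-(μ / A * (δ ^ 2 / (2 + δ)))) * #(Fintype.piFinset T) := by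
  have h := sum_piFinset_exp_le T Z hA hZ (-δ / A)
  rw [hμ, div_mul_cancel₀ _ hA.ne'] at h
  refine (Nat.cast_le.2 (card_le_card ?_)).trans (card_filter_le_of_sum_exp
    (c := -δ / A * ((1 - δ) * μ)) h ?_)
  · intro s hs
    rw [mem_filter] at hs ⊢
    refine ⟨hs.1, ?_⟩
    have h3 : δ / A * ∑ k, Z k (s k) ≤ δ / A * ((1 - δ) * μ) := by gcongr; exact hs.2
    rw [neg_div, neg_mul, neg_mul]
    exact neg_le_neg h3
  · have h2 := exp_neg_le_quadratic hδ
    have hm : 0 ≤ μ / A := by positivity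
    have e : -δ / A * ((1 - δ) * μ) = μ / A * (-δ * (1 - δ)) := by ring
    have h3 : δ ^ 2 / (2 + δ) ≤ δ ^ 2 / 2 := by gcongr; linarith
    rw [e, ← mul_sub, ← mul_neg]
    gcongr
    linarith

end Chernoff

section Resample

open Finset

variable {ι α : Type*} [Fintype ι] [DecidableEq ι]

/-- Conditioning on the coordinates outside `P`: if, for each choice `s` of all the coordinates,
redrawing the coordinates in `P` leads to the event `E` with probability at most `p`, then `E` has
probability at most `p`. -/
theorem card_filter_piFinset_le_of_resample (T : ι → Finset α) (P : ι → Prop)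
    [DecidablePred P] (E : (ι → α) → Prop) [DecidablePred E] {p : ℝ}
    (h : ∀ s ∈ Fintype.piFinset T,
      (#((Fintype.piFinset T).filter fun s' => E fun k => if P k then s' k else s k) : ℝ) ≤
        p * #(Fintype.piFinset T)) :
    (#((Fintype.piFinset T).filter E) : ℝ) ≤ p * #(Fintype.piFinset T) := by
  set S := Fintype.piFinset T
  let mix : (ι → α) → (ι → α) → ι → α := fun s s' k => if P k then s' k else s k
  have hmix : ∀ s ∈ S, ∀ s' ∈ S, mix s s' ∈ S := by
    intro s hs s' hs'
    rw [Fintype.mem_piFinset] at hs hs' ⊢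
    intro k
    by_cases hk : P k
    · simpa [mix, hk] using hs' k
    · simpa [mix, hk] using hs k
  have hinv : ∀ s s', mix (mix s s') (mix s' s) = s := by
    intro s s'
    funext k
    by_cases hk : P k <;> simp [mix, hk]
  rcases S.eq_empty_or_nonempty with h0 | h0
  · simp [h0]
  have hS : (0 : ℝ) < #S := by exact_mod_cast h0.card_pos
  -- Exchanging the coordinates in `P` is an involution of the pairs of sample points.
  have hcard : #(S.filter E ×ˢ S) = #((S ×ˢ S).filter fun q => E (mix q.1 q.2)) := by
    refine card_bij' (fun q _ => (mix q.1 q.2, mix q.2 q.1)) (fun q _ => (mix q.1 q.2, mix q.2 q.1))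
      ?_ ?_ ?_ ?_
    · rintro ⟨s, s'⟩ hq
      simp only [mem_product, mem_filter] at hq ⊢
      exact ⟨⟨hmix _ hq.1.1 _ hq.2, hmix _ hq.2 _ hq.1.1⟩, by rw [hinv]; exact hq.1.2⟩
    · rintro ⟨s, s'⟩ hq
      simp only [mem_product, mem_filter] at hq ⊢
      exact ⟨⟨hmix _ hq.1.1 _ hq.1.2, hq.2⟩, hmix _ hq.1.2 _ hq.1.1⟩
    · rintro ⟨s, s'⟩ _
      simp only [hinv]
    · rintro ⟨s, s'⟩ _
      simp only [hinv]
  have hsum : #((S ×ˢ S).filter fun q => E (mix q.1 q.2)) =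
      ∑ s ∈ S, #(S.filter fun s' => E (mix s s')) := by
    rw [card_filter, sum_product]
    simp only [card_filter]
  have : (#(S.filter E) : ℝ) * #S ≤ p * #S * #S := by
    calc (#(S.filter E) : ℝ) * #S = ∑ s ∈ S, (#(S.filter fun s' => E (mix s s')) : ℝ) := by
          rw [← Nat.cast_mul, ← card_product, hcard, hsum, Nat.cast_sum]
      _ ≤ ∑ s ∈ S, p * #S := sum_le_sum h
      _ = p * #S * #S := by simp; ring
  exact le_of_mul_le_mul_right this hS

end Resample

namespace AllocationInstance

open Finset

variable {V : Type*} [Fintype V] (I : AllocationInstance V)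

/-! ### Concentration of the estimates -/

theorem mem_N {w a : V} : a ∈ I.N w ↔ I.graph.Adj w a := by simp [N]

theorem mem_N_comm {w a : V} : a ∈ I.N w ↔ w ∈ I.N a := by
  rw [mem_N, mem_N, I.graph.adj_comm]

theorem mem_R_of_mem_N {u v : V} (hu : u ∈ I.L) (hv : v ∈ I.N u) : v ∈ I.R :=
  I.bipartite.mem_of_mem_adj hu (I.mem_N.1 hv)

theorem mem_L_of_mem_N {u v : V} (hv : v ∈ I.R) (hu : u ∈ I.N v) : u ∈ I.L :=
  I.bipartite.symm.mem_of_mem_adj hv (I.mem_N.1 hu)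

omit [Fintype V] in
theorem notMem_L {v : V} (hv : v ∈ I.R) : v ∉ I.L := fun h =>
  Set.disjoint_left.1 I.bipartite.disjoint h hv

theorem mem_group {ε : ℝ} {g : V → ℝ} {w a : V} {x : ℤ} :
    a ∈ I.group ε g w x ↔ a ∈ I.N w ∧ (1 + ε) ^ (x - 1) < g a ∧ g a ≤ (1 + ε) ^ x := by
  simp [group]

theorem group_subset (ε : ℝ) (g : V → ℝ) (w : V) (x : ℤ) : I.group ε g w x ⊆ I.N w :=
  filter_subset _ _

theorem group_unique {ε : ℝ} (hε : 0 < ε) {g : V → ℝ} {w a : V} {x y : ℤ}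
    (hx : a ∈ I.group ε g w x) (hy : a ∈ I.group ε g w y) : x = y := by
  rw [mem_group] at hx hy
  have h1 := hx.2.1.trans_le hy.2.2
  have h2 := hy.2.1.trans_le hx.2.2
  rw [zpow_lt_zpow_iff_right₀ (by linarith)] at h1 h2
  omega

/-- The groups of `w` with levels `-2τ, …, 2τ` contain all neighbors of `w`. -/
def Covers (ε : ℝ) (τ : ℕ) (g : V → ℝ) (w : V) : Prop :=
  ∀ a ∈ I.N w, ∃ x : Level τ, a ∈ I.group ε g w x

theorem Covers.sum_group {I : AllocationInstance V} {ε : ℝ} (hε : 0 < ε) {τ : ℕ} {g : V → ℝ}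
    {w : V} (h : I.Covers ε τ g w) (f : V → ℝ) :
    ∑ x : Level τ, ∑ a ∈ I.group ε g w x, f a = ∑ a ∈ I.N w, f a := by
  have h1 : ∀ x : Level τ, ∑ a ∈ I.group ε g w x, f a =
      ∑ a ∈ I.N w, if a ∈ I.group ε g w x then f a else 0 := by
    intro x
    rw [← sum_filter]
    congr 1
    ext a
    simp only [mem_filter]
    exact ⟨fun ha => ⟨I.group_subset _ _ _ _ ha, ha⟩, fun ha => ha.2⟩
  simp only [h1]
  rw [sum_comm]
  refine sum_congr rfl fun a ha => ?_
  obtain ⟨x, hx⟩ := h a ha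
  rw [Fintype.sum_eq_single x, if_pos hx]
  intro y hy
  rw [if_neg]
  exact fun hay => hy (Subtype.ext (I.group_unique hε hay hx))

/-- The set of all outcomes of the samples of one round. -/
noncomputable abbrev outcomes (ε : ℝ) (τ t : ℕ) (g : V → ℝ) : Finset (Samples V τ t) :=
  Fintype.piFinset fun k : V × Level τ × Fin t => I.sampleSet ε g k.1 k.2.1

theorem mem_group_of_mem_outcomes {ε : ℝ} {τ t : ℕ} {g : V → ℝ} {s : Samples V τ t}
    (hs : s ∈ I.outcomes ε τ t g) {w : V} {x : Level τ} (hx : (I.group ε g w x).Nonempty)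
    (i : Fin t) : s (w, x, i) ∈ I.group ε g w x := by
  have := Fintype.mem_piFinset.1 hs (w, x, i)
  simpa [sampleSet, hx] using this

theorem estimate_congr {ε : ℝ} {τ t : ℕ} {g : V → ℝ} {s : Samples V τ t}
    (hs : s ∈ I.outcomes ε τ t g) {w : V} {f f' : V → ℝ} (h : ∀ a ∈ I.N w, f a = f' a) :
    I.estimate ε τ t g s w f = I.estimate ε τ t g s w f' := by
  refine sum_congr rfl fun x _ => ?_
  rcases (I.group ε g w x).eq_empty_or_nonempty with h0 | h0
  · simp [h0]
  · congr 1
    exact sum_congr rfl fun i _ =>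
      h _ (I.group_subset _ _ _ _ (I.mem_group_of_mem_outcomes hs h0 i))

theorem estimate_mono {ε : ℝ} {τ t : ℕ} {g : V → ℝ} {s : Samples V τ t}
    (hs : s ∈ I.outcomes ε τ t g) {w : V} {f f' : V → ℝ} (h : ∀ a ∈ I.N w, f a ≤ f' a) :
    I.estimate ε τ t g s w f ≤ I.estimate ε τ t g s w f' := by
  refine sum_le_sum fun x _ => ?_
  rcases (I.group ε g w x).eq_empty_or_nonempty with h0 | h0
  · simp [h0]
  · gcongr with i
    exact h _ (I.group_subset _ _ _ _ (I.mem_group_of_mem_outcomes hs h0 i))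

theorem estimate_const_mul (ε : ℝ) (τ t : ℕ) (g : V → ℝ) (s : Samples V τ t) (w : V) (c : ℝ)
    (f : V → ℝ) :
    I.estimate ε τ t g s w (fun a => c * f a) = c * I.estimate ε τ t g s w f := by
  simp only [estimate, mul_sum]
  refine sum_congr rfl fun x _ => sum_congr rfl fun i _ => by ring

/-- The estimate is exact for a function that is constant on every group. -/
theorem estimate_eq_sum {ε : ℝ} (hε : 0 < ε) {τ t : ℕ} (ht : 0 < t) {g : V → ℝ} {w : V}
    (hcov : I.Covers ε τ g w) {s : Samples V τ t} (hs : s ∈ I.outcomes ε τ t g) {f : V → ℝ}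
    (hf : ∀ x : Level τ, ∀ a ∈ I.group ε g w x, ∀ b ∈ I.group ε g w x, f a = f b) :
    I.estimate ε τ t g s w f = ∑ a ∈ I.N w, f a := by
  rw [← hcov.sum_group hε, estimate]
  refine sum_congr rfl fun x _ => ?_
  rcases (I.group ε g w x).eq_empty_or_nonempty with h0 | ⟨b, hb⟩
  · simp [h0]
  · rw [sum_congr rfl fun i _ => hf x _ (I.mem_group_of_mem_outcomes hs ⟨b, hb⟩ i) b hb,
      sum_congr rfl fun a ha => hf x a ha b hb]
    have : (t : ℝ) ≠ 0 := by positivity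
    simp only [sum_const, card_univ, Fintype.card_fin, nsmul_eq_mul]
    field_simp

/-- The contribution of the sample with index `k` to the estimate of `w`. -/
noncomputable def sampleTerm (ε : ℝ) (τ t : ℕ) (g : V → ℝ) (w : V) (f : V → ℝ) (k : V × Level τ × Fin t)
    (a : V) : ℝ :=
  if k.1 = w then ((I.group ε g w k.2.1).card : ℝ) / t * f a else 0

theorem estimate_eq_sum_sampleTerm (ε : ℝ) (τ t : ℕ) (g : V → ℝ) (s : Samples V τ t) (w : V)
    (f : V → ℝ) :
    I.estimate ε τ t g s w f = ∑ k, I.sampleTerm ε τ t g w f k (s k) := by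
  rw [Fintype.sum_prod_type, Fintype.sum_eq_single w]
  · simp only [Fintype.sum_prod_type, sampleTerm, if_true, estimate, mul_sum]
  · intro w' hw'
    simp [sampleTerm, hw']

theorem sum_mean_sampleTerm {ε : ℝ} (hε : 0 < ε) {τ t : ℕ} (ht : 0 < t) {g : V → ℝ} {w : V}
    (hcov : I.Covers ε τ g w) (f : V → ℝ) :
    ∑ k : V × Level τ × Fin t, (∑ a ∈ I.sampleSet ε g k.1 k.2.1, I.sampleTerm ε τ t g w f k a) /
      #(I.sampleSet ε g k.1 k.2.1) = ∑ a ∈ I.N w, f a := by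
  rw [Fintype.sum_prod_type, Fintype.sum_eq_single w]
  · rw [Fintype.sum_prod_type, ← hcov.sum_group hε]
    refine sum_congr rfl fun x _ => ?_
    have : (t : ℝ) ≠ 0 := by positivity
    rcases (I.group ε g w x).eq_empty_or_nonempty with h0 | h0
    · simp [sampleTerm, h0]
    · have hc : (#(I.group ε g w x) : ℝ) ≠ 0 := by exact_mod_cast h0.card_pos.ne'
      simp only [sampleTerm, sampleSet, h0, if_true, ← mul_sum, sum_const, card_univ,
        Fintype.card_fin, nsmul_eq_mul]
      field_simp
  · intro w' hw'
    simp [sampleTerm, hw']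

/-- If `f` varies by a factor of at most `M` on each group, a sample contributes at most the fraction
`M / t` of the sum that is estimated. -/
theorem sampleTerm_mem_Icc {ε : ℝ} {τ t : ℕ} {g : V → ℝ} {w : V} {f : V → ℝ} {M : ℝ} (hM0 : 0 ≤ M) (hf : ∀ a ∈ I.N w, 0 ≤ f a)
    (hM : ∀ x : Level τ, ∀ a ∈ I.group ε g w x, ∀ b ∈ I.group ε g w x, f a ≤ M * f b)
    (k : V × Level τ × Fin t) (a : V) (ha : a ∈ I.sampleSet ε g k.1 k.2.1) :
    0 ≤ I.sampleTerm ε τ t g w f k a ∧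
      I.sampleTerm ε τ t g w f k a ≤ M * (∑ a ∈ I.N w, f a) / t := by
  have hS : 0 ≤ ∑ a ∈ I.N w, f a := sum_nonneg hf
  obtain ⟨w', x, i⟩ := k
  unfold sampleTerm
  split_ifs with hw
  · subst hw
    dsimp only at ha ⊢
    rcases (I.group ε g w' x).eq_empty_or_nonempty with h0 | h0
    · simp only [h0, card_empty, Nat.cast_zero, zero_div, zero_mul, le_refl, true_and]
      positivity
    · simp only [sampleSet, h0, if_true] at ha
      have hfa := hf a (I.group_subset _ _ _ _ ha)
      refine ⟨by positivity, ?_⟩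
      rw [div_mul_eq_mul_div]
      refine div_le_div_of_nonneg_right ?_ (Nat.cast_nonneg t)
      calc (#(I.group ε g w' x) : ℝ) * f a = ∑ b ∈ I.group ε g w' x, f a := by simp
        _ ≤ ∑ b ∈ I.group ε g w' x, M * f b := sum_le_sum fun b hb => hM x a ha b hb
        _ = M * ∑ b ∈ I.group ε g w' x, f b := by rw [mul_sum]
        _ ≤ M * ∑ b ∈ I.N w', f b := mul_le_mul_of_nonneg_left
          (sum_le_sum_of_subset_of_nonneg (I.group_subset _ _ _ _) fun b hb _ => hf b hb) hM0
  · exact ⟨le_rfl, by positivity⟩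

/-- Concentration of the estimate of `w` for a fixed function. -/
theorem card_estimate_bad_le {ε : ℝ} (hε : 0 < ε) {τ t : ℕ} (ht : 0 < t) {g : V → ℝ} {w : V}
    (hcov : I.Covers ε τ g w) {f : V → ℝ} {M δ : ℝ} (hδ : 0 ≤ δ) (hf : ∀ a ∈ I.N w, 0 < f a)
    (hM : ∀ x : Level τ, ∀ a ∈ I.group ε g w x, ∀ b ∈ I.group ε g w x, f a ≤ M * f b) :
    (#((I.outcomes ε τ t g).filter fun s =>
      ¬ ((1 - δ) * ∑ a ∈ I.N w, f a ≤ I.estimate ε τ t g s w f ∧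
        I.estimate ε τ t g s w f ≤ (1 + δ) * ∑ a ∈ I.N w, f a)) : ℝ) ≤
      2 * Real.exp (-(t / M * (δ ^ 2 / (2 + δ)))) * #(I.outcomes ε τ t g) := by
  rcases (I.N w).eq_empty_or_nonempty with h0 | ⟨a, ha⟩
  · have h1 : ∀ x, I.group ε g w x = ∅ := fun x =>
      subset_empty.1 (h0 ▸ I.group_subset ε g w x)
    simp only [h0, sum_empty, estimate, h1, card_empty, Nat.cast_zero, zero_div, zero_mul,
      sum_const_zero, mul_zero, le_refl, and_self, not_true_eq_false, filter_false]
    positivity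
  set S := ∑ a ∈ I.N w, f a with hSdef
  have hS : 0 < S := sum_pos hf ⟨a, ha⟩
  have hM0 : 0 < M := by
    obtain ⟨x, hx⟩ := hcov a ha
    exact pos_of_mul_pos_left ((hf a ha).trans_le (hM x a hx a hx)) (hf a ha).le
  have ht' : (0 : ℝ) < t := by exact_mod_cast ht
  have hA : 0 < M * S / t := by positivity
  have hZ := I.sampleTerm_mem_Icc (t := t) hM0.le (fun a ha => (hf a ha).le) hM
  have hmean := I.sum_mean_sampleTerm hε ht hcov f
  have hu := chernoff_upper (fun k : V × Level τ × Fin t => I.sampleSet ε g k.1 k.2.1)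
    (I.sampleTerm ε τ t g w f) hA hZ hmean hS.le hδ
  have hl := chernoff_lower (fun k : V × Level τ × Fin t => I.sampleSet ε g k.1 k.2.1)
    (I.sampleTerm ε τ t g w f) hA hZ hmean hS.le hδ
  have e : S / (M * S / t) = t / M := by field_simp
  simp only [← estimate_eq_sum_sampleTerm, ← hSdef, e] at hu hl
  have hsub : ((I.outcomes ε τ t g).filter fun s =>
      ¬ ((1 - δ) * S ≤ I.estimate ε τ t g s w f ∧ I.estimate ε τ t g s w f ≤ (1 + δ) * S)) ⊆
      ((I.outcomes ε τ t g).filter fun s => (1 + δ) * S ≤ I.estimate ε τ t g s w f) ∪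
      ((I.outcomes ε τ t g).filter fun s => I.estimate ε τ t g s w f ≤ (1 - δ) * S) := by
    intro s hs
    simp only [mem_filter, mem_union] at hs ⊢
    by_cases h : (1 - δ) * S ≤ I.estimate ε τ t g s w f
    · exact Or.inl ⟨hs.1, (not_le.1 fun h' => hs.2 ⟨h, h'⟩).le⟩
    · exact Or.inr ⟨hs.1, (not_le.1 h).le⟩
  have h1 := (card_le_card hsub).trans (card_union_le _ _)
  have h2 : (_ : ℝ) ≤ _ := Nat.cast_le.2 h1
  rw [Nat.cast_add] at h2
  exact h2.trans ((add_le_add hu hl).trans_eq (by ring))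

/-- Concentration of the estimate of `w` for a function `F s` that depends on the samples `s`, but not
on those of `w`. -/
theorem card_estimate_bad_le_of_indep {ε : ℝ} (hε : 0 < ε) {τ t : ℕ} (ht : 0 < t) {g : V → ℝ}
    {w : V} (hcov : I.Covers ε τ g w) (F : Samples V τ t → V → ℝ) {M δ : ℝ} (hδ : 0 ≤ δ)
    (hF : ∀ s s' : Samples V τ t, (∀ k, k.1 ≠ w → s k = s' k) → ∀ a ∈ I.N w, F s a = F s' a)
    (hpos : ∀ s ∈ I.outcomes ε τ t g, ∀ a ∈ I.N w, 0 < F s a)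
    (hM : ∀ s ∈ I.outcomes ε τ t g, ∀ x : Level τ, ∀ a ∈ I.group ε g w x,
      ∀ b ∈ I.group ε g w x, F s a ≤ M * F s b) :
    (#((I.outcomes ε τ t g).filter fun s =>
      ¬ ((1 - δ) * ∑ a ∈ I.N w, F s a ≤ I.estimate ε τ t g s w (F s) ∧
        I.estimate ε τ t g s w (F s) ≤ (1 + δ) * ∑ a ∈ I.N w, F s a)) : ℝ) ≤
      2 * Real.exp (-(t / M * (δ ^ 2 / (2 + δ)))) * #(I.outcomes ε τ t g) := by
  refine card_filter_piFinset_le_of_resample _ (fun k => k.1 = w) _ fun s hs => ?_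
  refine le_trans ?_ (I.card_estimate_bad_le hε ht hcov hδ (hpos s hs) (hM s hs))
  refine Nat.cast_le.2 (card_le_card fun s' hs' => ?_)
  rw [mem_filter] at hs' ⊢
  refine ⟨hs'.1, ?_⟩
  obtain ⟨h1, h2⟩ := hs'
  set m : Samples V τ t := fun k => if k.1 = w then s' k else s k with hm
  have hFm : ∀ a ∈ I.N w, F m a = F s a := hF m s fun k hk => by simp [hm, hk]
  have he : I.estimate ε τ t g m w (F m) = I.estimate ε τ t g s' w (F s) := by
    rw [← I.estimate_congr h1 hFm]
    simp [estimate, hm]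
  rw [he, sum_congr rfl hFm] at h2
  exact h2

end AllocationInstance

namespace AllocationInstance

open Finset

variable {V : Type*} [Fintype V] (I : AllocationInstance V)

/-! ### The invariant of the rounds -/

/-- The priorities of the left vertices agree with the sums of the priorities of their neighbors, up to
a relative error of `δ` and the change of the priorities in one round. -/
def Calibrated (ε δ : ℝ) (g : V → ℝ) : Prop :=
  ∀ u ∈ I.L, (1 - δ) / (1 + ε) * ∑ v ∈ I.N u, g v ≤ g u ∧
    g u ≤ (1 + δ) * (1 + ε) * ∑ v ∈ I.N u, g v

/-- The priorities `g` are suited to define groups after `r` rounds: on `R` they are powers of `1 + ε`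
with exponents `c` in `[-r, r]`, and those on `L` are calibrated. -/
structure Grouping (ε δ : ℝ) (r : ℕ) (g : V → ℝ) (c : V → ℤ) : Prop where
  eq_zpow : ∀ v ∈ I.R, g v = (1 + ε) ^ c v
  le : ∀ v ∈ I.R, c v ≤ r
  neg_le : ∀ v ∈ I.R, -r ≤ c v
  calibrated : I.Calibrated ε δ g

/-- The priorities of the right vertices after `r` rounds are `(1 + ε) ^ b`, with `b` in `[-r, r]`. A
vertex that is not on the highest level is almost full, and a vertex that is not on the lowest level is
not much overfull, up to the factor `κ`. -/
structure Balanced (ε κ : ℝ) (r : ℕ) (β : V → ℝ) (b : V → ℤ) : Prop where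
  eq_zpow : ∀ v ∈ I.R, β v = (1 + ε) ^ b v
  le : ∀ v ∈ I.R, b v ≤ r
  neg_le : ∀ v ∈ I.R, -r ≤ b v
  cap_le : ∀ v ∈ I.R, b v < r → (I.C v : ℝ) ≤ κ * I.alloc β v
  le_cap : ∀ v ∈ I.R, -r < b v → I.alloc β v ≤ κ * I.C v

section Group

variable {I} {ε δ κ : ℝ} {r τ t : ℕ} {g β : V → ℝ} {b c : V → ℤ}

theorem Grouping.pos (h : I.Grouping ε δ r g c) (hε : 0 < ε) {v : V} (hv : v ∈ I.R) : 0 < g v := by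
  rw [h.eq_zpow v hv]; positivity

theorem Balanced.pos (h : I.Balanced ε κ r β b) (hε : 0 < ε) {v : V} (hv : v ∈ I.R) : 0 < β v := by
  rw [h.eq_zpow v hv]; positivity

theorem Grouping.covers (h : I.Grouping ε δ r g c) (hε : 0 < ε) (hr : r < τ) (hδ : 0 ≤ δ)
    (hlow : 1 ≤ (1 - δ) * (1 + ε) ^ τ) (hupp : (1 + δ) * #I.R ≤ (1 + ε) ^ τ) (w : V) :
    I.Covers ε τ g w := by
  intro a ha
  have h1 : (1 : ℝ) < 1 + ε := by linarith
  have h0 : (0 : ℝ) < 1 + ε := by linarith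
  rcases I.cover a with haL | haR
  · have hw : w ∈ I.N a := I.mem_N_comm.1 ha
    have hwR := I.mem_R_of_mem_N haL hw
    have hδ1 : 0 < 1 - δ := by
      by_contra hcon
      push Not at hcon
      nlinarith [pow_pos h0 τ]
    have hS1 : (1 + ε) ^ (-(r : ℤ)) ≤ ∑ v ∈ I.N a, g v := by
      calc (1 + ε) ^ (-(r : ℤ)) ≤ (1 + ε) ^ c w := by
            gcongr
            · exact h1.le
            · exact h.neg_le w hwR
        _ = g w := (h.eq_zpow w hwR).symm
        _ ≤ _ := single_le_sum (f := g)
            (fun v hv => (h.pos hε (I.mem_R_of_mem_N haL hv)).le) hw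
    have hS2 : ∑ v ∈ I.N a, g v ≤ #I.R * (1 + ε) ^ r := by
      calc ∑ v ∈ I.N a, g v ≤ ∑ v ∈ I.N a, (1 + ε) ^ r := sum_le_sum fun v hv => by
            have hvR := I.mem_R_of_mem_N haL hv
            rw [h.eq_zpow v hvR, ← zpow_natCast]
            gcongr
            · exact h1.le
            · exact h.le v hvR
        _ = #(I.N a) * (1 + ε) ^ r := by simp
        _ ≤ _ := by
            gcongr
            exact fun v hv => I.mem_R_of_mem_N haL hv
    obtain ⟨hc1, hc2⟩ := h.calibrated a haL
    have hg2 : g a ≤ (1 + ε) ^ (2 * (τ : ℤ)) := by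
      calc g a ≤ (1 + δ) * (1 + ε) * (#I.R * (1 + ε) ^ r) := hc2.trans (by gcongr)
        _ = (1 + δ) * #I.R * (1 + ε) ^ (r + 1) := by ring
        _ ≤ (1 + ε) ^ τ * (1 + ε) ^ τ := by
          gcongr
          · exact h1.le
          · omega
        _ = _ := by rw [two_mul, zpow_add₀ h0.ne', zpow_natCast]
    have hg1 : (1 + ε) ^ (-(2 * (τ : ℤ))) ≤ g a := by
      calc (1 + ε) ^ (-(2 * (τ : ℤ))) = 1 * (1 + ε) ^ (-(2 * (τ : ℤ))) := (one_mul _).symm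
        _ ≤ (1 - δ) * (1 + ε) ^ τ * (1 + ε) ^ (-(2 * (τ : ℤ))) := by gcongr
        _ = (1 - δ) * (1 + ε) ^ (-(τ : ℤ)) := by
          rw [← zpow_natCast, mul_assoc, ← zpow_add₀ h0.ne']
          congr 2
          ring
        _ ≤ (1 - δ) * (1 + ε) ^ (-(r : ℤ) - 1) := by
          gcongr
          · exact h1.le
          · omega
        _ = (1 - δ) / (1 + ε) * (1 + ε) ^ (-(r : ℤ)) := by
          rw [zpow_sub_one₀ h0.ne']; ring
        _ ≤ (1 - δ) / (1 + ε) * ∑ v ∈ I.N a, g v := by gcongr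
        _ ≤ g a := hc1
    have hg0 : 0 < g a := lt_of_lt_of_le (by positivity) hg1
    obtain ⟨n, hn1, hn2⟩ := exists_mem_Ioc_zpow hg0 h1
    have e1 := hn1.trans_le hg2
    have e2 := hg1.trans hn2
    rw [zpow_lt_zpow_iff_right₀ h1] at e1
    rw [zpow_le_zpow_iff_right₀ h1] at e2
    refine ⟨⟨n + 1, Finset.mem_Icc.2 ⟨by omega, by omega⟩⟩, I.mem_group.2 ⟨ha, ?_, hn2⟩⟩
    simpa using hn1
  · have e1 := h.le a haR
    have e2 := h.neg_le a haR
    refine ⟨⟨c a, Finset.mem_Icc.2 ⟨by omega, by omega⟩⟩, I.mem_group.2 ⟨ha, ?_, ?_⟩⟩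
    · rw [h.eq_zpow a haR]
      exact zpow_lt_zpow_right₀ h1 (by simp)
    · rw [h.eq_zpow a haR]

/-- On the groups of a left vertex, the priorities that define the groups are constant. -/
theorem Grouping.eq_of_mem_group (h : I.Grouping ε δ r g c) (hε : 0 < ε) {u : V} (hu : u ∈ I.L)
    {x : ℤ} {a : V} (ha : a ∈ I.group ε g u x) : g a = (1 + ε) ^ x := by
  have h1 : (1 : ℝ) < 1 + ε := by linarith
  rw [mem_group] at ha
  have haR := I.mem_R_of_mem_N hu ha.1
  rw [h.eq_zpow a haR, zpow_lt_zpow_iff_right₀ h1, zpow_le_zpow_iff_right₀ h1] at ha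
  rw [h.eq_zpow a haR]
  congr 1
  omega

/-- The priorities of the right vertices have changed by at most the factor `(1 + ε) ^ j` since the
groups were formed. -/
def Near (I : AllocationInstance V) (ε : ℝ) (j : ℕ) (g β : V → ℝ) : Prop :=
  ∀ v ∈ I.R, g v ≤ (1 + ε) ^ j * β v ∧ β v ≤ (1 + ε) ^ j * g v

omit [Fintype V] in
theorem near_of_exponents {j : ℕ} (hε : 0 < ε) (hg : ∀ v ∈ I.R, g v = (1 + ε) ^ c v)
    (hβ : ∀ v ∈ I.R, β v = (1 + ε) ^ b v)
    (hj : ∀ v ∈ I.R, b v ≤ c v + j ∧ c v ≤ b v + j) : I.Near ε j g β := by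
  have h1 : (1 : ℝ) ≤ 1 + ε := by linarith
  have h0 : (1 + ε : ℝ) ≠ 0 := by linarith
  intro v hv
  rw [hg v hv, hβ v hv, ← zpow_natCast, ← zpow_add₀ h0, ← zpow_add₀ h0]
  obtain ⟨h2, h3⟩ := hj v hv
  exact ⟨zpow_le_zpow_right₀ h1 (by omega), zpow_le_zpow_right₀ h1 (by omega)⟩

/-- The estimates of the left vertices never leave a fixed range around the exact sums at the beginning
of the phase, whatever the samples are. -/
theorem Grouping.estimate_mem_Icc {j : ℕ} (h : I.Grouping ε δ r g c) (hε : 0 < ε)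
    (hn : I.Near ε j g β) (ht : 0 < t) {u : V} (hu : u ∈ I.L) (hcov : I.Covers ε τ g u)
    {s : Samples V τ t} (hs : s ∈ I.outcomes ε τ t g) :
    ∑ v ∈ I.N u, g v ≤ (1 + ε) ^ j * I.estimate ε τ t g s u β ∧
      I.estimate ε τ t g s u β ≤ (1 + ε) ^ j * ∑ v ∈ I.N u, g v := by
  rw [← I.estimate_eq_sum hε ht hcov hs fun x a ha b hb => by
      rw [h.eq_of_mem_group hε hu ha, h.eq_of_mem_group hε hu hb],
    ← estimate_const_mul, ← estimate_const_mul]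
  exact ⟨I.estimate_mono hs fun a ha => (hn a (I.mem_R_of_mem_N hu ha)).1,
    I.estimate_mono hs fun a ha => (hn a (I.mem_R_of_mem_N hu ha)).2⟩

theorem Grouping.estimate_pos {j : ℕ} (h : I.Grouping ε δ r g c) (hε : 0 < ε)
    (hn : I.Near ε j g β) (ht : 0 < t) {u : V} (hu : u ∈ I.L) (hcov : I.Covers ε τ g u)
    {s : Samples V τ t} (hs : s ∈ I.outcomes ε τ t g) (hne : (I.N u).Nonempty) :
    0 < I.estimate ε τ t g s u β := by
  have h1 := (h.estimate_mem_Icc hε hn ht hu hcov hs).1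
  have h2 : 0 < ∑ v ∈ I.N u, g v := sum_pos (fun v hv => h.pos hε (I.mem_R_of_mem_N hu hv)) hne
  exact pos_of_mul_pos_right (h2.trans_le h1) (by positivity)

/-- The function whose sum over the neighbors of `w` is estimated in a round. -/
noncomputable def target (I : AllocationInstance V) (ε : ℝ) (τ t : ℕ) (g β : V → ℝ)
    (s : Samples V τ t) (w : V) : V → ℝ :=
  if w ∈ I.L then β else fun u => β w / I.estimate ε τ t g s u β

/-- The bound for the variation of the estimated functions on a group. -/
noncomputable def groupSpread (ε δ : ℝ) (j : ℕ) : ℝ :=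
  (1 + ε) ^ (2 * j + 3) * ((1 + δ) / (1 - δ))

theorem Grouping.target_pos {j : ℕ} (h : I.Grouping ε δ r g c) (hβ : ∀ v ∈ I.R, 0 < β v)
    (hε : 0 < ε) (hn : I.Near ε j g β) (ht : 0 < t) (hcov : ∀ w, I.Covers ε τ g w)
    {s : Samples V τ t} (hs : s ∈ I.outcomes ε τ t g) {w a : V} (ha : a ∈ I.N w) :
    0 < I.target ε τ t g β s w a := by
  unfold target
  split_ifs with hw
  · exact hβ _ (I.mem_R_of_mem_N hw ha)
  · have hwR := (I.cover w).resolve_left hw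
    exact div_pos (hβ w hwR) (h.estimate_pos hε hn ht (I.mem_L_of_mem_N hwR ha) (hcov a) hs
      ⟨w, I.mem_N_comm.1 ha⟩)

theorem Grouping.target_le {j : ℕ} (h : I.Grouping ε δ r g c) (hβ : ∀ v ∈ I.R, 0 < β v)
    (hε : 0 < ε) (hδ : 0 ≤ δ) (hδ1 : δ < 1) (hn : I.Near ε j g β) (ht : 0 < t)
    (hcov : ∀ w, I.Covers ε τ g w) {s : Samples V τ t} (hs : s ∈ I.outcomes ε τ t g)
    {w : V} {x : ℤ} {a b : V} (ha : a ∈ I.group ε g w x) (hb : b ∈ I.group ε g w x) :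
    I.target ε τ t g β s w a ≤ groupSpread ε δ j * I.target ε τ t g β s w b := by
  have h1 : (1 : ℝ) ≤ 1 + ε := by linarith
  have h0 : (0 : ℝ) < 1 + ε := by linarith
  have hδ' : 0 < 1 - δ := by linarith
  have haN := I.group_subset _ _ _ _ ha
  have hbN := I.group_subset _ _ _ _ hb
  unfold target groupSpread
  split_ifs with hw
  · have hbR := I.mem_R_of_mem_N hw hbN
    have hρ : 1 ≤ (1 + δ) / (1 - δ) := by rw [one_le_div hδ']; linarith
    calc β a ≤ (1 + ε) ^ j * g a := (hn a (I.mem_R_of_mem_N hw haN)).2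
      _ = (1 + ε) ^ j * g b := by rw [h.eq_of_mem_group hε hw ha, h.eq_of_mem_group hε hw hb]
      _ ≤ (1 + ε) ^ j * ((1 + ε) ^ j * β b) := by gcongr; exact (hn b hbR).1
      _ = (1 + ε) ^ (2 * j) * 1 * β b := by ring
      _ ≤ (1 + ε) ^ (2 * j + 3) * ((1 + δ) / (1 - δ)) * β b := by
        have := (hβ b hbR).le
        gcongr
        omega
  · have hwR := (I.cover w).resolve_left hw
    have haL := I.mem_L_of_mem_N hwR haN
    have hbL := I.mem_L_of_mem_N hwR hbN
    set Ea := I.estimate ε τ t g s a β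
    set Eb := I.estimate ε τ t g s b β
    have hEa : 0 < Ea := h.estimate_pos hε hn ht haL (hcov a) hs ⟨w, I.mem_N_comm.1 haN⟩
    have hEb : 0 < Eb := h.estimate_pos hε hn ht hbL (hcov b) hs ⟨w, I.mem_N_comm.1 hbN⟩
    have key : Eb ≤ (1 + ε) ^ (2 * j + 3) * ((1 + δ) / (1 - δ)) * Ea := by
      have hga := (I.mem_group.1 ha).2.1
      have hgb := (I.mem_group.1 hb).2.2
      have hb1 : ∑ v ∈ I.N b, g v ≤ (1 + ε) / (1 - δ) * g b := by
        have := (h.calibrated b hbL).1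
        rw [div_mul_eq_mul_div, div_le_iff₀ h0] at this
        rw [div_mul_eq_mul_div, le_div_iff₀ hδ']
        linarith
      calc Eb ≤ (1 + ε) ^ j * ∑ v ∈ I.N b, g v :=
            (h.estimate_mem_Icc hε hn ht hbL (hcov b) hs).2
        _ ≤ (1 + ε) ^ j * ((1 + ε) / (1 - δ) * (1 + ε) ^ x) := by
            gcongr
            exact hb1.trans (by gcongr)
        _ = (1 + ε) ^ j * ((1 + ε) / (1 - δ)) * (1 + ε) * (1 + ε) ^ (x - 1) := by
            rw [zpow_sub_one₀ h0.ne']; field_simp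
        _ ≤ (1 + ε) ^ j * ((1 + ε) / (1 - δ)) * (1 + ε) *
            ((1 + δ) * (1 + ε) * ((1 + ε) ^ j * Ea)) := by
            gcongr
            exact hga.le.trans ((h.calibrated a haL).2.trans
              (by gcongr; exact (h.estimate_mem_Icc hε hn ht haL (hcov a) hs).1))
        _ = _ := by field_simp; ring
    have hβw := hβ w hwR
    rw [mul_div_assoc', div_le_div_iff₀ hEa hEb]
    calc β w * Eb ≤ β w * ((1 + ε) ^ (2 * j + 3) * ((1 + δ) / (1 - δ)) * Ea) := by gcongr
      _ = _ := by ring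

/-- The samples of a round are accurate if all estimates have a relative error of at most `δ`. -/
def Accurate (I : AllocationInstance V) (ε δ : ℝ) (τ t : ℕ) (g β : V → ℝ) (s : Samples V τ t) :
    Prop :=
  ∀ w, (1 - δ) * ∑ a ∈ I.N w, I.target ε τ t g β s w a ≤
      I.estimate ε τ t g s w (I.target ε τ t g β s w) ∧
    I.estimate ε τ t g s w (I.target ε τ t g β s w) ≤
      (1 + δ) * ∑ a ∈ I.N w, I.target ε τ t g β s w a

theorem card_not_accurate_le {j : ℕ} (h : I.Grouping ε δ r g c) (hβ : ∀ v ∈ I.R, 0 < β v)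
    (hε : 0 < ε) (hδ : 0 ≤ δ) (hδ1 : δ < 1) (hn : I.Near ε j g β) (ht : 0 < t)
    (hcov : ∀ w, I.Covers ε τ g w) :
    (#((I.outcomes ε τ t g).filter fun s => ¬ I.Accurate ε δ τ t g β s) : ℝ) ≤
      Fintype.card V * (2 * Real.exp (-(t / groupSpread ε δ j * (δ ^ 2 / (2 + δ))))) *
        #(I.outcomes ε τ t g) := by
  have hw : ∀ w, (#((I.outcomes ε τ t g).filter fun s =>
      ¬ ((1 - δ) * ∑ a ∈ I.N w, I.target ε τ t g β s w a ≤
          I.estimate ε τ t g s w (I.target ε τ t g β s w) ∧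
        I.estimate ε τ t g s w (I.target ε τ t g β s w) ≤
          (1 + δ) * ∑ a ∈ I.N w, I.target ε τ t g β s w a)) : ℝ) ≤
      2 * Real.exp (-(t / groupSpread ε δ j * (δ ^ 2 / (2 + δ)))) * #(I.outcomes ε τ t g) := by
    intro w
    refine I.card_estimate_bad_le_of_indep hε ht (hcov w) (fun s => I.target ε τ t g β s w) hδ ?_
      (fun s hs a ha => h.target_pos hβ hε hn ht hcov hs ha)
      (fun s hs x a ha b hb => h.target_le hβ hε hδ hδ1 hn ht hcov hs ha hb)
    intro s s' hss a ha
    unfold target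
    split_ifs with hwL
    · rfl
    · have hwR := (I.cover w).resolve_left hwL
      have haw : a ≠ w := fun e => hwL (e ▸ I.mem_L_of_mem_N hwR ha)
      have : I.estimate ε τ t g s a β = I.estimate ε τ t g s' a β :=
        sum_congr rfl fun x _ => by
          congr 1
          exact sum_congr rfl fun i _ => by rw [hss _ haw]
      dsimp only
      rw [this]
  have hsub : ((I.outcomes ε τ t g).filter fun s => ¬ I.Accurate ε δ τ t g β s) ⊆
      univ.biUnion fun w => (I.outcomes ε τ t g).filter fun s =>
      ¬ ((1 - δ) * ∑ a ∈ I.N w, I.target ε τ t g β s w a ≤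
          I.estimate ε τ t g s w (I.target ε τ t g β s w) ∧
        I.estimate ε τ t g s w (I.target ε τ t g β s w) ≤
          (1 + δ) * ∑ a ∈ I.N w, I.target ε τ t g β s w a) := by
    intro s hs
    rw [mem_filter, Accurate, not_forall] at hs
    obtain ⟨hs1, w, hs2⟩ := hs
    exact mem_biUnion.2 ⟨w, mem_univ w, mem_filter.2 ⟨hs1, hs2⟩⟩
  have h1 : (_ : ℝ) ≤ _ := Nat.cast_le.2 ((card_le_card hsub).trans card_biUnion_le)
  rw [Nat.cast_sum] at h1
  refine h1.trans ((sum_le_sum fun w _ => hw w).trans_eq ?_)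
  simp
  ring

end Group

end AllocationInstance

namespace AllocationInstance

open Finset

variable {V : Type*} [Fintype V] {I : AllocationInstance V}

/-! ### One round -/

/-- If all priorities change by a factor of at most `1 + ε` and that of `v` by the factor `q`, then the
allocation of `v` changes by the factor `q` up to another factor of `1 + ε`. -/
theorem alloc_step {ε q : ℝ} (hε : 0 < ε) {β β' : V → ℝ} (hβ : ∀ v ∈ I.R, 0 < β v)
    (hβ' : ∀ v ∈ I.R, β v ≤ (1 + ε) * β' v ∧ β' v ≤ (1 + ε) * β v) {v : V} (hv : v ∈ I.R)
    (hq : β' v = q * β v) (hq0 : 0 ≤ q) :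
    q * I.alloc β v ≤ (1 + ε) * I.alloc β' v ∧ I.alloc β' v ≤ (1 + ε) * (q * I.alloc β v) := by
  have h0 : (0 : ℝ) < 1 + ε := by linarith
  have hpos' : ∀ w ∈ I.R, 0 < β' w := fun w hw =>
    pos_of_mul_pos_right ((hβ w hw).trans_le (hβ' w hw).1) h0.le
  simp only [alloc, mul_sum]
  have key : ∀ u ∈ I.N v, q * I.proportional β u v ≤ (1 + ε) * I.proportional β' u v ∧
      I.proportional β' u v ≤ (1 + ε) * (q * I.proportional β u v) := by
    intro u hu
    have huL := I.mem_L_of_mem_N hv hu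
    have hvu : v ∈ I.N u := I.mem_N_comm.1 hu
    have hS : 0 < ∑ w ∈ I.N u, β w :=
      sum_pos (fun w hw => hβ w (I.mem_R_of_mem_N huL hw)) ⟨v, hvu⟩
    have hS' : 0 < ∑ w ∈ I.N u, β' w :=
      sum_pos (fun w hw => hpos' w (I.mem_R_of_mem_N huL hw)) ⟨v, hvu⟩
    have e1 : ∑ w ∈ I.N u, β w ≤ (1 + ε) * ∑ w ∈ I.N u, β' w := by
      rw [mul_sum]; exact sum_le_sum fun w hw => (hβ' w (I.mem_R_of_mem_N huL hw)).1
    have e2 : ∑ w ∈ I.N u, β' w ≤ (1 + ε) * ∑ w ∈ I.N u, β w := by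
      rw [mul_sum]; exact sum_le_sum fun w hw => (hβ' w (I.mem_R_of_mem_N huL hw)).2
    have hqb : 0 ≤ q * β v := mul_nonneg hq0 (hβ v hv).le
    unfold proportional
    rw [hq, mul_div_assoc', mul_div_assoc', mul_div_assoc', div_le_div_iff₀ hS hS',
      div_le_div_iff₀ hS' hS]
    constructor
    · nlinarith [mul_le_mul_of_nonneg_left e2 hqb]
    · nlinarith [mul_le_mul_of_nonneg_left e1 hqb]
  exact ⟨sum_le_sum fun u hu => (key u hu).1, sum_le_sum fun u hu => (key u hu).2⟩

theorem alloc_nonneg {β : V → ℝ} (hβ : ∀ v ∈ I.R, 0 < β v) {v : V} (hv : v ∈ I.R) :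
    0 ≤ I.alloc β v :=
  sum_nonneg fun _ hu => div_nonneg (hβ v hv).le (sum_nonneg fun w hw =>
    (hβ w (I.mem_R_of_mem_N (I.mem_L_of_mem_N hv hu) hw)).le)

variable {ε δ : ℝ} {r τ t : ℕ} {g β : V → ℝ} {b c : V → ℤ}

theorem newPriority_of_mem_L {s : Samples V τ t} {u : V} (hu : u ∈ I.L) :
    I.newPriority ε τ t g β s u = I.estimate ε τ t g s u β := by
  simp [newPriority, hu]

theorem newPriority_of_mem_R {s : Samples V τ t} {v : V} (hv : v ∈ I.R) :
    I.newPriority ε τ t g β s v = updatePriority ε (I.C v)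
      (I.estimate ε τ t g s v (I.target ε τ t g β s v)) (β v) := by
  simp [newPriority, target, I.notMem_L hv]

theorem Accurate.left {s : Samples V τ t} (h : I.Accurate ε δ τ t g β s) {u : V} (hu : u ∈ I.L) :
    (1 - δ) * ∑ v ∈ I.N u, β v ≤ I.newPriority ε τ t g β s u ∧
      I.newPriority ε τ t g β s u ≤ (1 + δ) * ∑ v ∈ I.N u, β v := by
  have := h u
  simp only [target, hu, if_true] at this
  rwa [newPriority_of_mem_L hu]

/-- With accurate samples the estimated allocation of a right vertex is correct up to the product of
the errors of the two estimates that it is composed of. -/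
theorem Accurate.right {s : Samples V τ t} (h : I.Accurate ε δ τ t g β s) (hδ : 0 ≤ δ) (hδ1 : δ < 1)
    (hβ : ∀ v ∈ I.R, 0 < β v) {v : V} (hv : v ∈ I.R) :
    I.alloc β v ≤ (1 + δ) / (1 - δ) * I.estimate ε τ t g s v (I.target ε τ t g β s v) ∧
      I.estimate ε τ t g s v (I.target ε τ t g β s v) ≤ (1 + δ) / (1 - δ) * I.alloc β v := by
  have hδ' : 0 < 1 - δ := by linarith
  have h1 : 0 < 1 + δ := by linarith
  obtain ⟨e1, e2⟩ := h v
  set E := I.estimate ε τ t g s v (I.target ε τ t g β s v)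
  have key : ∀ u ∈ I.N v, I.proportional β u v ≤ (1 + δ) * I.target ε τ t g β s v u ∧
      (1 - δ) * I.target ε τ t g β s v u ≤ I.proportional β u v := by
    intro u hu
    have huL := I.mem_L_of_mem_N hv hu
    have hS : 0 < ∑ w ∈ I.N u, β w :=
      sum_pos (fun w hw => hβ w (I.mem_R_of_mem_N huL hw)) ⟨v, I.mem_N_comm.1 hu⟩
    have hu' := h.left huL
    rw [newPriority_of_mem_L huL] at hu'
    simp only [target, I.notMem_L hv, if_false, proportional]
    have hEu : 0 < I.estimate ε τ t g s u β := lt_of_lt_of_le (by positivity) hu'.1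
    have := hβ v hv
    rw [mul_div_assoc', mul_div_assoc', div_le_div_iff₀ hS hEu, div_le_div_iff₀ hEu hS]
    constructor
    · nlinarith [mul_le_mul_of_nonneg_left hu'.2 this.le]
    · nlinarith [mul_le_mul_of_nonneg_left hu'.1 this.le]
  have k1 : I.alloc β v ≤ (1 + δ) * ∑ u ∈ I.N v, I.target ε τ t g β s v u := by
    rw [alloc, mul_sum]; exact sum_le_sum fun u hu => (key u hu).1
  have k2 : (1 - δ) * ∑ u ∈ I.N v, I.target ε τ t g β s v u ≤ I.alloc β v := by
    rw [alloc, mul_sum]; exact sum_le_sum fun u hu => (key u hu).2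
  rw [div_mul_eq_mul_div, div_mul_eq_mul_div, le_div_iff₀ hδ', le_div_iff₀ hδ']
  constructor
  · nlinarith
  · nlinarith

/-- The change of the exponent of the priority of a right vertex in a round. -/
noncomputable def exponentStep (I : AllocationInstance V) (ε : ℝ) (τ t : ℕ) (g β : V → ℝ)
    (s : Samples V τ t) (v : V) : ℤ :=
  if I.estimate ε τ t g s v (I.target ε τ t g β s v) ≤ I.C v / (1 + ε) then 1
  else if I.C v * (1 + ε) ≤ I.estimate ε τ t g s v (I.target ε τ t g β s v) then -1 else 0

theorem newPriority_eq_zpow_mul {s : Samples V τ t} {v : V} (hv : v ∈ I.R) :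
    I.newPriority ε τ t g β s v = (1 + ε) ^ I.exponentStep ε τ t g β s v * β v := by
  rw [newPriority_of_mem_R hv, updatePriority, exponentStep]
  split_ifs
  · rw [zpow_one, mul_comm]
  · rw [zpow_neg_one, div_eq_mul_inv, mul_comm]
  · simp

theorem exponentStep_mem (s : Samples V τ t) (v : V) :
    -1 ≤ I.exponentStep ε τ t g β s v ∧ I.exponentStep ε τ t g β s v ≤ 1 := by
  unfold exponentStep
  split_ifs <;> simp

theorem newPriority_near (hε : 0 < ε) (hβ : ∀ v ∈ I.R, 0 < β v) (s : Samples V τ t) :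
    ∀ v ∈ I.R, β v ≤ (1 + ε) * I.newPriority ε τ t g β s v ∧
      I.newPriority ε τ t g β s v ≤ (1 + ε) * β v := by
  intro v hv
  have h1 : (1 : ℝ) ≤ 1 + ε := by linarith
  have h0 : (1 + ε : ℝ) ≠ 0 := by linarith
  have hb := (hβ v hv).le
  obtain ⟨e1, e2⟩ := exponentStep_mem (I := I) (ε := ε) (g := g) (β := β) s v
  rw [newPriority_eq_zpow_mul hv, ← mul_assoc, ← zpow_one_add₀ h0]
  constructor
  · exact le_mul_of_one_le_left hb (one_le_zpow₀ h1 (by omega))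
  · gcongr
    calc (1 + ε) ^ I.exponentStep ε τ t g β s v ≤ (1 + ε) ^ (1 : ℤ) := zpow_le_zpow_right₀ h1 e2
      _ = 1 + ε := zpow_one _

theorem calibrated_newPriority (hε : 0 < ε) (hδ : 0 ≤ δ) (hδ1 : δ < 1)
    (hβ : ∀ v ∈ I.R, 0 < β v) {s : Samples V τ t} (h : I.Accurate ε δ τ t g β s) :
    I.Calibrated ε δ (I.newPriority ε τ t g β s) := by
  intro u hu
  have h0 : (0 : ℝ) < 1 + ε := by linarith
  have hδ' : 0 < 1 - δ := by linarith
  have hn := newPriority_near (I := I) (g := g) hε hβ s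
  obtain ⟨e1, e2⟩ := h.left hu
  set β' := I.newPriority ε τ t g β s
  have k1 : ∑ v ∈ I.N u, β v ≤ (1 + ε) * ∑ v ∈ I.N u, β' v := by
    rw [mul_sum]; exact sum_le_sum fun v hv => (hn v (I.mem_R_of_mem_N hu hv)).1
  have k2 : ∑ v ∈ I.N u, β' v ≤ (1 + ε) * ∑ v ∈ I.N u, β v := by
    rw [mul_sum]; exact sum_le_sum fun v hv => (hn v (I.mem_R_of_mem_N hu hv)).2
  constructor
  · rw [div_mul_eq_mul_div, div_le_iff₀ h0]
    nlinarith
  · nlinarith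

/-- The factor up to which the vertices of intermediate levels are balanced. -/
noncomputable def slack (ε δ : ℝ) : ℝ := (1 + δ) / (1 - δ) * (1 + ε) ^ 2

/-- The invariant is preserved. A vertex leaves the highest level only if it is almost full, and from
then on its allocation decreases only in rounds in which its priority is not raised, hence in which it
is estimated to be almost full; and similarly for the lowest level. -/
theorem Balanced.newPriority (hε : 0 < ε) (hδ : 0 ≤ δ) (hδ1 : δ < 1)
    (hb : I.Balanced ε (slack ε δ) r β b) {s : Samples V τ t} (h : I.Accurate ε δ τ t g β s) :
    I.Balanced ε (slack ε δ) (r + 1) (I.newPriority ε τ t g β s)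
      (fun v => b v + I.exponentStep ε τ t g β s v) := by
  have hβ : ∀ v ∈ I.R, 0 < β v := fun v hv => hb.pos hε hv
  have h0 : (0 : ℝ) < 1 + ε := by linarith
  have hδ' : 0 < 1 - δ := by linarith
  have hn := newPriority_near (I := I) (g := g) hε hβ s
  have main : ∀ v ∈ I.R, (b v + I.exponentStep ε τ t g β s v < (r + 1 : ℕ) →
      (I.C v : ℝ) ≤ slack ε δ * I.alloc (I.newPriority ε τ t g β s) v) ∧
      (-((r + 1 : ℕ) : ℤ) < b v + I.exponentStep ε τ t g β s v →
        I.alloc (I.newPriority ε τ t g β s) v ≤ slack ε δ * I.C v) := by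
    intro v hv
    obtain ⟨s1, s2⟩ := alloc_step hε hβ hn hv (newPriority_eq_zpow_mul hv)
      (zpow_nonneg h0.le _)
    obtain ⟨a1, a2⟩ := h.right hδ hδ1 hβ hv
    have hA := alloc_nonneg hβ hv
    have hc := hb.cap_le v hv
    have hc' := hb.le_cap v hv
    unfold slack at hc hc' ⊢
    set A' := I.alloc (I.newPriority ε τ t g β s) v
    set A := I.alloc β v
    set C : ℝ := (I.C v : ℝ)
    have hC : 0 ≤ C := Nat.cast_nonneg _
    set ρ := (1 + δ) / (1 - δ) with hρdef
    have hρ : 1 ≤ ρ := by rw [hρdef, one_le_div hδ']; linarith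
    set e := 1 + ε with he
    have he1 : 1 ≤ e := by linarith
    have he2 : e ≤ e ^ 2 := by nlinarith
    unfold exponentStep at s1 s2 ⊢
    set E := I.estimate ε τ t g s v (I.target ε τ t g β s v)
    push_cast
    split_ifs at s1 s2 ⊢ with h1 h2
    · rw [zpow_one] at s1 s2
      have hAA : A ≤ A' := le_of_mul_le_mul_left s1 h0
      refine ⟨fun hlt => (hc (by omega)).trans (by gcongr), fun _ => ?_⟩
      rw [le_div_iff₀ h0] at h1
      calc A' ≤ e * (e * A) := s2
        _ ≤ e * (e * (ρ * E)) := by gcongr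
        _ = ρ * e * (E * e) := by ring
        _ ≤ ρ * e * C := by gcongr
        _ ≤ ρ * e ^ 2 * C := by gcongr
    · rw [zpow_neg_one] at s1 s2
      have hAA : A' ≤ A := by rwa [mul_inv_cancel_left₀ h0.ne'] at s2
      rw [inv_mul_le_iff₀ h0] at s1
      refine ⟨fun _ => ?_, fun hlt => hAA.trans (hc' (by omega))⟩
      have : e * C ≤ e * (ρ * e * A') := by
        calc e * C = C * e := by ring
          _ ≤ E := h2
          _ ≤ ρ * A := a2
          _ ≤ ρ * (e * (e * A')) := by gcongr
          _ = _ := by ring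
      have hA' : 0 ≤ A' := by
        have : 0 ≤ e * (e * A') := hA.trans s1
        exact nonneg_of_mul_nonneg_right (nonneg_of_mul_nonneg_right this h0) h0
      calc C ≤ ρ * e * A' := le_of_mul_le_mul_left this h0
        _ ≤ ρ * e ^ 2 * A' := by gcongr
    · rw [zpow_zero, one_mul] at s1 s2
      rw [not_le] at h1 h2
      rw [div_lt_iff₀ h0] at h1
      constructor
      · intro _
        calc C ≤ E * e := h1.le
          _ ≤ (ρ * A) * e := by gcongr
          _ ≤ (ρ * (e * A')) * e := by gcongr
          _ = _ := by ring
      · intro _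
        calc A' ≤ e * A := s2
          _ ≤ e * (ρ * E) := by gcongr
          _ ≤ e * (ρ * (C * e)) := by gcongr
          _ = _ := by ring
  refine ⟨fun v hv => ?_, fun v hv => ?_, fun v hv => ?_, fun v hv => (main v hv).1,
    fun v hv => (main v hv).2⟩
  · rw [newPriority_eq_zpow_mul hv, hb.eq_zpow v hv, ← zpow_add₀ h0.ne', add_comm (b v)]
  · have := hb.le v hv
    have := (exponentStep_mem (I := I) (ε := ε) (g := g) (β := β) s v).2
    push_cast; omega
  · have := hb.neg_le v hv
    have := (exponentStep_mem (I := I) (ε := ε) (g := g) (β := β) s v).1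
    push_cast; omega

/-- The priorities that determine the groups in the round after the first `r` rounds. -/
noncomputable def groupPriority (B r : ℕ) (S : State V) : V → ℝ :=
  if r % B = 0 then S.β else S.phaseStart

/-- The invariant after `r` rounds: the current priorities are balanced, and those that define the
groups of the next round are calibrated and close to the current ones. -/
def Good (I : AllocationInstance V) (ε δ : ℝ) (B r : ℕ) (S : State V) : Prop :=
  ∃ b c : V → ℤ, I.Balanced ε (slack ε δ) r S.β b ∧ I.Grouping ε δ r (groupPriority B r S) c ∧
    ∀ v ∈ I.R, b v ≤ c v + (r % B : ℕ) ∧ c v ≤ b v + (r % B : ℕ)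

theorem good_initState (hε : 0 < ε) (hδ : 0 ≤ δ) (B : ℕ) :
    I.Good ε δ B 0 I.initState := by
  have hR : ∀ v ∈ I.R, I.initPriority v = 1 := fun v hv => by simp [initPriority, I.notMem_L hv]
  refine ⟨0, 0, ⟨?_, ?_, ?_, ?_, ?_⟩, ⟨?_, ?_, ?_, ?_⟩, ?_⟩
  · intro v hv; simp [initState, hR v hv]
  · simp
  · simp
  · simp
  · simp
  · intro v hv; simp [groupPriority, initState, hR v hv]
  · simp
  · simp
  · intro u hu
    have hS : ∑ v ∈ I.N u, I.initPriority v = #(I.N u) := by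
      rw [sum_congr rfl fun v hv => hR v (I.mem_R_of_mem_N hu hv)]; simp
    have hg : groupPriority B 0 I.initState = I.initPriority := by
      simp [groupPriority, initState]
    have hu' : I.initPriority u = #(I.N u) := by simp [initPriority, hu]
    rw [hg, hS, hu']
    have hN : (0 : ℝ) ≤ #(I.N u) := Nat.cast_nonneg _
    constructor
    · refine mul_le_of_le_one_left hN ?_
      rw [div_le_one (by linarith)]
      linarith
    · exact le_mul_of_one_le_left hN (by nlinarith)
  · simp

theorem Good.step (hε : 0 < ε) (hδ : 0 ≤ δ) (hδ1 : δ < 1) {B : ℕ} {S : State V}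
    (hS : I.Good ε δ B r S) {s : Samples V τ t}
    (h : I.Accurate ε δ τ t (groupPriority B r S) S.β s) (x : V → V → ℝ) :
    I.Good ε δ B (r + 1)
      ⟨groupPriority B r S, I.newPriority ε τ t (groupPriority B r S) S.β s, x⟩ := by
  obtain ⟨b, c, hb, hc, hbc⟩ := hS
  have hβ : ∀ v ∈ I.R, 0 < S.β v := fun v hv => hb.pos hε hv
  have hb' := hb.newPriority hε hδ hδ1 h
  by_cases h0 : (r + 1) % B = 0
  · refine ⟨_, _, hb', ⟨?_, hb'.le, hb'.neg_le, ?_⟩, ?_⟩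
    · simpa only [groupPriority, h0, if_true] using hb'.eq_zpow
    · simpa only [groupPriority, h0, if_true] using calibrated_newPriority hε hδ hδ1 hβ h
    · simp [h0]
  · have hmod : (r + 1) % B = r % B + 1 := by
      rcases Nat.eq_zero_or_pos B with rfl | hB
      · simp
      · rw [Nat.add_mod] at h0 ⊢
        have h2 := Nat.mod_lt r hB
        rcases Nat.lt_or_ge 1 B with h3 | h3
        · rw [Nat.mod_eq_of_lt h3] at h0 ⊢
          rcases Nat.lt_or_ge (r % B + 1) B with h4 | h4
          · exact Nat.mod_eq_of_lt h4
          · have : r % B + 1 = B := by omega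
            rw [this, Nat.mod_self] at h0
            exact absurd rfl h0
        · have : B = 1 := by omega
          subst this
          simp [Nat.mod_one] at h0
    refine ⟨_, c, hb', ⟨?_, ?_, ?_, ?_⟩, ?_⟩
    · simpa only [groupPriority, h0, if_false] using hc.eq_zpow
    · intro v hv
      have := hc.le v hv
      push_cast; omega
    · intro v hv
      have := hc.neg_le v hv
      push_cast; omega
    · simpa only [groupPriority, h0, if_false] using hc.calibrated
    · intro v hv
      have h1 := hbc v hv
      have h2 := exponentStep_mem (I := I) (ε := ε) (g := groupPriority B r S) (β := S.β) s v
      rw [hmod]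
      push_cast at h1 ⊢
      constructor <;> omega

end AllocationInstance

namespace AllocationInstance

open Finset

variable {V : Type*} [Fintype V] {I : AllocationInstance V}

/-! ### Approximation ratio of balanced priorities -/

theorem sum_edges_comm (I : AllocationInstance V) (F : V → V → ℝ) :
    ∑ u ∈ I.L, ∑ v ∈ I.N u, F u v = ∑ v ∈ I.R, ∑ u ∈ I.N v, F u v := by
  refine sum_comm' fun u v => ?_
  constructor
  · rintro ⟨hu, hv⟩
    exact ⟨I.mem_N_comm.1 hv, I.mem_R_of_mem_N hu hv⟩
  · rintro ⟨hu, hv⟩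
    exact ⟨I.mem_L_of_mem_N hv hu, I.mem_N_comm.1 hu⟩

/-- The fractions of the edges of a right vertex add up to at most its capacity, and those of the edges
of a left vertex to at most one. So the weight is at most the total capacity of the right vertices
with `b v ≤ j` plus the number of left vertices that have another neighbor. -/
theorem IsFractionalAllocation.weight_le {y : V → V → ℝ} (hy : I.IsFractionalAllocation y)
    (b : V → ℤ) (j : ℤ) :
    I.weight y ≤ ∑ v ∈ I.R with b v ≤ j, (I.C v : ℝ) + #{u ∈ I.L | ∃ v ∈ I.N u, j < b v} := by
  have h1 : I.weight y = ∑ u ∈ I.L, ∑ v ∈ I.N u, (if b v ≤ j then y u v else 0) +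
      ∑ u ∈ I.L, ∑ v ∈ I.N u, (if b v ≤ j then 0 else y u v) := by
    simp only [weight, ← sum_add_distrib]
    refine sum_congr rfl fun u _ => sum_congr rfl fun v _ => ?_
    split_ifs <;> simp
  rw [h1, sum_edges_comm]
  gcongr
  · rw [sum_filter]
    refine sum_le_sum fun v hv => ?_
    split_ifs
    · exact hy.2.2 v hv
    · simp
  · rw [card_filter, Nat.cast_sum]
    refine sum_le_sum fun u hu => ?_
    split_ifs with h
    · rw [Nat.cast_one]
      refine (sum_le_sum fun v hv => ?_).trans (hy.2.1 u hu)
      split_ifs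
      · exact (hy.1 u hu v hv).1
      · exact le_rfl
    · rw [Nat.cast_zero]
      refine (sum_eq_zero fun v hv => ?_).le
      rw [if_pos]
      by_contra hcon
      exact h ⟨v, hv, not_le.1 hcon⟩

variable {β : V → ℝ}

theorem proportional_nonneg (hβ : ∀ v ∈ I.R, 0 < β v) {u v : V} (hu : u ∈ I.L) (hv : v ∈ I.N u) :
    0 ≤ I.proportional β u v :=
  div_nonneg (hβ v (I.mem_R_of_mem_N hu hv)).le
    (sum_nonneg fun w hw => (hβ w (I.mem_R_of_mem_N hu hw)).le)

theorem sum_proportional (hβ : ∀ v ∈ I.R, 0 < β v) {u : V} (hu : u ∈ I.L)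
    (hne : (I.N u).Nonempty) : ∑ v ∈ I.N u, I.proportional β u v = 1 := by
  have hS : 0 < ∑ w ∈ I.N u, β w := sum_pos (fun w hw => hβ w (I.mem_R_of_mem_N hu hw)) hne
  simp only [proportional, ← sum_div]
  exact div_self hS.ne'

theorem sum_rescaled (hβ : ∀ v ∈ I.R, 0 < β v) {v : V} (hv : v ∈ I.R) :
    ∑ u ∈ I.N v, I.rescaled β u v = min (I.alloc β v) (I.C v) := by
  simp only [rescaled, ← mul_sum]
  have hA := alloc_nonneg hβ hv
  change min 1 ((I.C v : ℝ) / I.alloc β v) * I.alloc β v = _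
  rcases hA.eq_or_lt with h0 | h0
  · rw [← h0]; simp
  · rw [min_mul_of_nonneg _ _ hA, one_mul, div_mul_cancel₀ _ h0.ne']

theorem isFractionalAllocation_rescaled (hβ : ∀ v ∈ I.R, 0 < β v) :
    I.IsFractionalAllocation (I.rescaled β) := by
  have hle : ∀ u ∈ I.L, ∀ v ∈ I.N u, I.rescaled β u v ≤ I.proportional β u v := fun u hu v hv =>
    mul_le_of_le_one_left (proportional_nonneg hβ hu hv) (min_le_left _ _)
  have hnn : ∀ u ∈ I.L, ∀ v ∈ I.N u, 0 ≤ I.rescaled β u v := fun u hu v hv =>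
    mul_nonneg (le_min zero_le_one (div_nonneg (Nat.cast_nonneg _)
      (alloc_nonneg hβ (I.mem_R_of_mem_N hu hv)))) (proportional_nonneg hβ hu hv)
  have hsum : ∀ u ∈ I.L, ∑ v ∈ I.N u, I.rescaled β u v ≤ 1 := by
    intro u hu
    rcases (I.N u).eq_empty_or_nonempty with h0 | h0
    · simp [h0]
    · exact (sum_le_sum fun v hv => hle u hu v hv).trans (sum_proportional hβ hu h0).le
  refine ⟨fun u hu v hv => ⟨hnn u hu v hv, ?_⟩, hsum, fun v hv => ?_⟩
  · exact (single_le_sum (f := fun v => I.rescaled β u v) (fun w hw => hnn u hu w hw) hv).trans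
      (hsum u hu)
  · rw [sum_rescaled hβ hv]
    exact min_le_right _ _

theorem weight_rescaled (hβ : ∀ v ∈ I.R, 0 < β v) :
    I.weight (I.rescaled β) = ∑ v ∈ I.R, min (I.alloc β v) (I.C v) := by
  rw [weight, sum_edges_comm]
  exact sum_congr rfl fun v hv => sum_rescaled hβ hv

variable {ε κ η : ℝ} {r m : ℕ} {b : V → ℤ}

/-- A left vertex with a neighbor above level `j` gives almost all of its fraction to neighbors above
level `j - m`, since the priorities of the others are negligible. -/
theorem one_sub_le_sum_proportional (hε : 0 < ε) (hb : ∀ v ∈ I.R, β v = (1 + ε) ^ b v)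
    (hm : #I.R ≤ η * (1 + ε) ^ m) {j : ℤ} {u v₀ : V} (hu : u ∈ I.L) (hv₀ : v₀ ∈ I.N u)
    (hj : j < b v₀) :
    1 - η ≤ ∑ v ∈ I.N u with j - m < b v, I.proportional β u v := by
  have h1 : (1 : ℝ) ≤ 1 + ε := by linarith
  have h0 : (0 : ℝ) < 1 + ε := by linarith
  have hβ : ∀ v ∈ I.R, 0 < β v := fun v hv => by rw [hb v hv]; positivity
  have hS : (1 + ε) ^ j ≤ ∑ w ∈ I.N u, β w := by
    calc (1 + ε) ^ j ≤ (1 + ε) ^ b v₀ := zpow_le_zpow_right₀ h1 hj.le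
      _ = β v₀ := (hb v₀ (I.mem_R_of_mem_N hu hv₀)).symm
      _ ≤ _ := single_le_sum (f := β) (fun w hw => (hβ w (I.mem_R_of_mem_N hu hw)).le) hv₀
  have hS0 : 0 < ∑ w ∈ I.N u, β w := lt_of_lt_of_le (by positivity) hS
  have hlow : ∑ v ∈ I.N u with ¬ j - m < b v, I.proportional β u v ≤ η := by
    simp only [proportional, ← sum_div]
    rw [div_le_iff₀ hS0]
    have hη : 0 ≤ η := by
      by_contra hcon
      push Not at hcon
      nlinarith [pow_pos h0 m, (Nat.cast_nonneg #I.R : (0 : ℝ) ≤ #I.R)]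
    calc ∑ v ∈ I.N u with ¬ j - m < b v, β v
        ≤ ∑ v ∈ I.N u with ¬ j - m < b v, (1 + ε) ^ (j - m) := sum_le_sum fun v hv => by
          rw [mem_filter, not_lt] at hv
          rw [hb v (I.mem_R_of_mem_N hu hv.1)]
          exact zpow_le_zpow_right₀ h1 hv.2
      _ = #{v ∈ I.N u | ¬ j - m < b v} * (1 + ε) ^ (j - m) := by simp
      _ ≤ #I.R * (1 + ε) ^ (j - m) := by
          gcongr
          exact fun v hv => I.mem_R_of_mem_N hu (mem_filter.1 hv).1
      _ ≤ η * (1 + ε) ^ m * (1 + ε) ^ (j - m) := by gcongr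
      _ = η * (1 + ε) ^ j := by
          rw [mul_assoc, ← zpow_natCast, ← zpow_add₀ h0.ne']
          congr 2
          ring
      _ ≤ _ := by gcongr
  have := sum_filter_add_sum_filter_not (I.N u) (fun v => j - m < b v)
    (fun v => I.proportional β u v)
  rw [sum_proportional hβ hu ⟨v₀, hv₀⟩] at this
  linarith

theorem card_mul_le_sum_alloc (hε : 0 < ε) (hb : ∀ v ∈ I.R, β v = (1 + ε) ^ b v)
    (hm : #I.R ≤ η * (1 + ε) ^ m) (j : ℤ) :
    (#{u ∈ I.L | ∃ v ∈ I.N u, j < b v} : ℝ) * (1 - η) ≤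
      ∑ v ∈ I.R with j - m < b v, I.alloc β v := by
  have hβ : ∀ v ∈ I.R, 0 < β v := fun v hv => by rw [hb v hv]; positivity
  have h1 : ∑ v ∈ I.R with j - m < b v, I.alloc β v =
      ∑ u ∈ I.L, ∑ v ∈ I.N u with j - m < b v, I.proportional β u v := by
    simp only [sum_filter]
    rw [sum_edges_comm I fun u v => if j - m < b v then I.proportional β u v else 0]
    refine sum_congr rfl fun v _ => ?_
    split_ifs
    · rfl
    · simp
  rw [h1, ← nsmul_eq_mul, ← sum_const]
  refine (sum_le_sum fun u hu => ?_).trans (sum_le_sum_of_subset_of_nonneg (filter_subset _ _)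
    fun u hu _ => sum_nonneg fun v hv => proportional_nonneg hβ hu (mem_filter.1 hv).1)
  rw [mem_filter] at hu
  obtain ⟨hu, v, hv, hj⟩ := hu
  exact one_sub_le_sum_proportional hε hb hm hu hv hj

/-- The bound for a fixed level `j`: the vertices with levels in `(j - m, j]` are counted twice. -/
theorem Balanced.weight_le (hb : I.Balanced ε κ r β b) (hε : 0 < ε) (hκ : 1 ≤ κ) (hη0 : 0 ≤ η)
    (hη : η < 1) (hm : #I.R ≤ η * (1 + ε) ^ m) {j : ℤ} (hj : j < r) (hjm : -r ≤ j - m)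
    {y : V → V → ℝ} (hy : I.IsFractionalAllocation y) :
    I.weight y ≤ κ / (1 - η) * (I.weight (I.rescaled β) +
      ∑ v ∈ I.R with j - m < b v ∧ b v ≤ j, min (I.alloc β v) (I.C v)) := by
  have hη' : 0 < 1 - η := by linarith
  have hβ : ∀ v ∈ I.R, 0 < β v := fun v hv => hb.pos hε hv
  set F : V → ℝ := fun v => min (I.alloc β v) (I.C v) with hF
  have hF0 : ∀ v ∈ I.R, 0 ≤ F v := fun v hv => le_min (alloc_nonneg hβ hv) (Nat.cast_nonneg _)
  have h1 : ∑ v ∈ I.R with b v ≤ j, (I.C v : ℝ) ≤ κ / (1 - η) * ∑ v ∈ I.R with b v ≤ j, F v := by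
    rw [mul_sum]
    refine sum_le_sum fun v hv => ?_
    rw [mem_filter] at hv
    have hC : (0 : ℝ) ≤ I.C v := Nat.cast_nonneg _
    have : (I.C v : ℝ) ≤ κ * F v := by
      rw [hF]; dsimp only
      rw [mul_min_of_nonneg _ _ (by linarith)]
      exact le_min (hb.cap_le v hv.1 (by omega)) (le_mul_of_one_le_left hC hκ)
    refine this.trans (mul_le_mul_of_nonneg_right ?_ (hF0 v hv.1))
    rw [le_div_iff₀ hη']
    nlinarith
  have h2 : ∑ v ∈ I.R with j - m < b v, I.alloc β v ≤ κ * ∑ v ∈ I.R with j - m < b v, F v := by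
    rw [mul_sum]
    refine sum_le_sum fun v hv => ?_
    rw [mem_filter] at hv
    rw [hF]; dsimp only
    rw [mul_min_of_nonneg _ _ (by linarith)]
    exact le_min (le_mul_of_one_le_left (alloc_nonneg hβ hv.1) hκ) (hb.le_cap v hv.1 (by omega))
  have h3 : (#{u ∈ I.L | ∃ v ∈ I.N u, j < b v} : ℝ) ≤
      κ / (1 - η) * ∑ v ∈ I.R with j - m < b v, F v := by
    rw [div_mul_eq_mul_div, le_div_iff₀ hη']
    exact (card_mul_le_sum_alloc hε hb.eq_zpow hm j).trans h2
  have h4 : ∑ v ∈ I.R with b v ≤ j, F v + ∑ v ∈ I.R with j - m < b v, F v =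
      ∑ v ∈ I.R, F v + ∑ v ∈ I.R with j - m < b v ∧ b v ≤ j, F v := by
    simp only [sum_filter, ← sum_add_distrib]
    refine sum_congr rfl fun v _ => ?_
    by_cases c1 : b v ≤ j <;> by_cases c2 : j - m < b v
    · simp [c1, c2]
    · simp [c1, c2]
    · simp [c1, c2]
    · omega
  refine (hy.weight_le b j).trans ((add_le_add h1 h3).trans_eq ?_)
  rw [← mul_add, h4, weight_rescaled hβ]

omit [Fintype V] in
/-- Among `K` disjoint windows of `m` consecutive levels, one carries at most the fraction `1 / K` of
the weight. -/
theorem exists_light_window (F : V → ℝ) (s : Finset V) (hF : ∀ v ∈ s, 0 ≤ F v) (b : V → ℤ) (m : ℕ)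
    (top : ℤ) {K : ℕ} (hK : 0 < K) :
    ∃ k < K, ∑ v ∈ s with top - k * m - m < b v ∧ b v ≤ top - k * m, F v ≤ (∑ v ∈ s, F v) / K := by
  have hK' : (K : ℝ) ≠ 0 := by positivity
  have hsum : ∑ k ∈ range K, ∑ v ∈ s with top - k * m - m < b v ∧ b v ≤ top - k * m, F v ≤
      ∑ k ∈ range K, (∑ v ∈ s, F v) / K := by
    have : ∑ k ∈ range K, (∑ v ∈ s, F v) / K = ∑ v ∈ s, F v := by
      simp only [sum_const, card_range, nsmul_eq_mul]
      field_simp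
    rw [this]
    simp only [sum_filter]
    rw [sum_comm]
    refine sum_le_sum fun v hv => ?_
    rw [← sum_filter, sum_const]
    have hone : #((range K).filter fun k : ℕ => top - k * m - m < b v ∧ b v ≤ top - k * m) ≤ 1 := by
      rw [card_le_one]
      intro k hk k' hk'
      rw [mem_filter] at hk hk'
      by_contra hne
      rcases Nat.lt_or_gt_of_ne hne with h | h
      · have : ((k : ℤ) + 1) * m ≤ k' * m := by gcongr; omega
        linarith [hk.2.1, hk'.2.2]
      · have : ((k' : ℤ) + 1) * m ≤ k * m := by gcongr; omega
        linarith [hk'.2.1, hk.2.2]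
    calc _ ≤ 1 • F v := nsmul_le_nsmul_left (hF v hv) hone
      _ = F v := one_nsmul _
  obtain ⟨k, hk, h⟩ := exists_le_of_sum_le ⟨0, mem_range.2 hK⟩ hsum
  exact ⟨k, mem_range.1 hk, h⟩

theorem Balanced.isApprox (hb : I.Balanced ε κ r β b) (hε : 0 < ε) (hκ : 1 ≤ κ) (hη0 : 0 ≤ η)
    (hη : η < 1) (hm : #I.R ≤ η * (1 + ε) ^ m) {K : ℕ} (hK : 0 < K) (hKm : K * m + 1 ≤ 2 * r) :
    I.IsApproxFractionalAllocation (κ / (1 - η) * (1 + 1 / K)) (I.rescaled β) := by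
  have hη' : 0 < 1 - η := by linarith
  have hβ : ∀ v ∈ I.R, 0 < β v := fun v hv => hb.pos hε hv
  refine ⟨isFractionalAllocation_rescaled hβ, fun y hy => ?_⟩
  obtain ⟨k, hk, hw⟩ := exists_light_window (fun v => min (I.alloc β v) (I.C v : ℝ)) I.R
    (fun v hv => le_min (alloc_nonneg hβ hv) (Nat.cast_nonneg _)) b m (r - 1) hK
  have h1 : (k + 1) * m ≤ K * m := by gcongr; omega
  have h2 : ((k : ℤ) + 1) * m + 1 ≤ 2 * r := by exact_mod_cast (by omega : (k + 1) * m + 1 ≤ 2 * r)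
  have h3 : (0 : ℤ) ≤ k * m := by positivity
  refine (hb.weight_le hε hκ hη0 hη hm (j := r - 1 - k * m) (by linarith) (by linarith)
    hy).trans ?_
  rw [← weight_rescaled hβ] at hw
  have hκ0 : 0 ≤ κ / (1 - η) := by positivity
  calc _ ≤ κ / (1 - η) * (I.weight (I.rescaled β) + I.weight (I.rescaled β) / K) := by gcongr
    _ = _ := by ring

end AllocationInstance

namespace AllocationInstance

open Finset

/-! ### Numerical estimates -/

section Numerics

variable {ε : ℝ}

theorem le_log_one_add (hε : 0 < ε) (hε' : ε ≤ 1 / 4) : 8 / 9 * ε ≤ Real.log (1 + ε) := by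
  refine le_trans ?_ (Real.le_log_one_add_of_nonneg hε.le)
  rw [le_div_iff₀ (by linarith)]
  nlinarith

theorem log_two_mul_div_nonneg (hε : 0 < ε) (hε' : ε ≤ 1 / 4) {N : ℝ} (hN : 1 ≤ N) :
    0 ≤ Real.log (2 * N / ε) := by
  refine Real.log_nonneg ?_
  rw [le_div_iff₀ hε]
  linarith

theorem div_le_one_add_pow (hε : 0 < ε) {N : ℝ} (hN : 1 ≤ N) {k : ℕ}
    (hk : Real.log (2 * N / ε) ≤ k * Real.log (1 + ε)) : 2 * N / ε ≤ (1 + ε) ^ k := by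
  rw [← Real.log_pow] at hk
  exact (Real.log_le_log_iff (by positivity) (by positivity)).1 hk

theorem div_le_one_add_pow_rounds (hε : 0 < ε) (hε' : ε ≤ 1 / 4) {N : ℝ} (hN : 1 ≤ N) {τ : ℕ}
    (hτ : 2 * Real.log (2 * N / ε) / ε ^ 2 + 1 / ε ≤ τ) : 2 * N / ε ≤ (1 + ε) ^ τ := by
  refine div_le_one_add_pow hε hN ?_
  have hΛ := log_two_mul_div_nonneg hε hε' hN
  set Λ := Real.log (2 * N / ε)
  calc Λ ≤ 2 * Λ / ε ^ 2 * (8 / 9 * ε) := by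
        rw [div_mul_eq_mul_div, le_div_iff₀ (by positivity)]
        nlinarith [mul_nonneg hΛ hε.le, mul_le_mul_of_nonneg_left hε' (mul_nonneg hΛ hε.le)]
    _ ≤ τ * Real.log (1 + ε) := by
        gcongr
        · have : 0 < 1 / ε := by positivity
          linarith
        · exact le_log_one_add hε hε'

/-- There are enough levels for `⌈1 / ε⌉` windows, each so high that the priorities below it are
negligible compared to those above it. -/
theorem exists_windows (hε : 0 < ε) (hε' : ε ≤ 1 / 4) {N : ℝ} (hN : 1 ≤ N) {r : ℕ}
    (hr : 2 * Real.log (2 * N / ε) / ε ^ 2 + 1 / ε ≤ (r + 1 : ℕ)) :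
    ∃ K m : ℕ, 0 < K ∧ 1 / (K : ℝ) ≤ ε ∧ N ≤ ε / 2 * (1 + ε) ^ m ∧ K * m + 1 ≤ 2 * r := by
  have hΛ := log_two_mul_div_nonneg hε hε' hN
  have hlog := le_log_one_add hε hε'
  have hlog0 : 0 < Real.log (1 + ε) := lt_of_lt_of_le (by positivity) hlog
  have hm := div_le_one_add_pow (k := ⌈Real.log (2 * N / ε) / Real.log (1 + ε)⌉₊) hε hN (by
    rw [← div_le_iff₀ hlog0]; exact Nat.le_ceil _)
  set Λ := Real.log (2 * N / ε)
  have hε1 : 4 ≤ 1 / ε := by rw [le_div_iff₀ hε]; linarith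
  have hK0 : 0 < ⌈1 / ε⌉₊ := Nat.ceil_pos.2 (by positivity)
  refine ⟨⌈1 / ε⌉₊, ⌈Λ / Real.log (1 + ε)⌉₊, hK0, ?_, ?_, ?_⟩
  · rw [div_le_iff₀ (by exact_mod_cast hK0), ← div_le_iff₀' hε]
    exact Nat.le_ceil _
  · rw [div_le_iff₀ hε] at hm
    linarith
  · have h1 : (⌈1 / ε⌉₊ : ℝ) ≤ 5 / 4 * (1 / ε) := by
      have := (Nat.ceil_lt_add_one (show 0 ≤ 1 / ε by positivity)).le
      linarith
    have h2 : (⌈Λ / Real.log (1 + ε)⌉₊ : ℝ) ≤ 9 / 8 * Λ * (1 / ε) + 1 := by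
      refine (Nat.ceil_lt_add_one (by positivity)).le.trans ?_
      gcongr
      rw [div_le_iff₀ hlog0]
      calc Λ = 9 / 8 * Λ * (1 / ε) * (8 / 9 * ε) := by field_simp
        _ ≤ _ := by gcongr
    have h3 : (⌈1 / ε⌉₊ : ℝ) * ⌈Λ / Real.log (1 + ε)⌉₊ + 1 ≤ 2 * r := by
      have hz : 2 * Λ / ε ^ 2 = 2 * Λ * (1 / ε) ^ 2 := by field_simp
      rw [hz] at hr
      push_cast at hr
      have h4 := mul_le_mul h1 h2 (Nat.cast_nonneg _) (by positivity)
      have h5 : 0 ≤ Λ * (1 / ε) ^ 2 := by positivity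
      nlinarith
    exact_mod_cast h3

theorem slack_div_mul_le (hε : 0 < ε) (hε' : ε ≤ 1 / 4) {K : ℕ} (hK : 1 / (K : ℝ) ≤ ε) :
    slack ε (3 / 2 * ε) / (1 - ε / 2) * (1 + 1 / K) ≤ 1 + 18 * ε := by
  have h1 : 0 < 1 - 3 / 2 * ε := by linarith
  have h2 : 0 < 1 - ε / 2 := by linarith
  unfold slack
  calc (1 + 3 / 2 * ε) / (1 - 3 / 2 * ε) * (1 + ε) ^ 2 / (1 - ε / 2) * (1 + 1 / K)
      ≤ (1 + 3 / 2 * ε) / (1 - 3 / 2 * ε) * (1 + ε) ^ 2 / (1 - ε / 2) * (1 + ε) := by gcongr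
    _ = (1 + 3 / 2 * ε) * (1 + ε) ^ 3 / ((1 - 3 / 2 * ε) * (1 - ε / 2)) := by field_simp
    _ ≤ _ := by
      rw [div_le_iff₀ (by positivity)]
      have e2 : ε ^ 2 ≤ ε * (1 / 4) := by nlinarith
      have e3 : ε ^ 3 ≤ ε * (1 / 16) := by nlinarith
      have e4 : ε ^ 4 ≤ ε * (1 / 64) := by nlinarith
      have e0 : 0 ≤ ε ^ 3 := by positivity
      nlinarith

/-- The exponent in the Chernoff bound for `t = ⌈(1+ε)^(2B) ε⁻⁵ log n⌉` samples. -/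
theorem le_chernoff_exponent (hε : 0 < ε) (hε' : ε ≤ 1 / 4) {ℓ t : ℝ} (hℓ : 0 ≤ ℓ) {B j : ℕ}
    (hj : j < B) (ht : (1 + ε) ^ (2 * B) * (ε ^ 5)⁻¹ * ℓ ≤ t) :
    ℓ / (3 * ε ^ 3) ≤
      t / groupSpread ε (3 / 2 * ε) j * ((3 / 2 * ε) ^ 2 / (2 + 3 / 2 * ε)) := by
  have h1 : 0 < 1 - 3 / 2 * ε := by linarith
  have hs : groupSpread ε (3 / 2 * ε) j ≤
      (1 + ε) ^ (2 * B) * ((1 + ε) * ((1 + 3 / 2 * ε) / (1 - 3 / 2 * ε))) := by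
    unfold groupSpread
    rw [← mul_assoc, ← pow_succ]
    exact mul_le_mul_of_nonneg_right (pow_le_pow_right₀ (by linarith) (by omega)) (by positivity)
  have hs0 : 0 < groupSpread ε (3 / 2 * ε) j := by unfold groupSpread; positivity
  have key : (1 + ε) * (1 + 3 / 2 * ε) * (2 + 3 / 2 * ε) ≤ 3 * (9 / 4) * (1 - 3 / 2 * ε) := by
    nlinarith [mul_pos hε hε, mul_nonneg (mul_pos hε hε).le (sub_nonneg.2 hε')]
  calc ℓ / (3 * ε ^ 3) = ℓ * (ε ^ 5)⁻¹ * (1 / 3) * ε ^ 2 := by field_simp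
    _ ≤ ℓ * (ε ^ 5)⁻¹ * (9 / 4 * (1 - 3 / 2 * ε) /
          ((1 + ε) * (1 + 3 / 2 * ε) * (2 + 3 / 2 * ε))) * ε ^ 2 := by
        have : 1 / 3 ≤ 9 / 4 * (1 - 3 / 2 * ε) /
            ((1 + ε) * (1 + 3 / 2 * ε) * (2 + 3 / 2 * ε)) := by
          rw [div_le_div_iff₀ (by norm_num) (by positivity)]
          linarith
        gcongr
    _ = (1 + ε) ^ (2 * B) * (ε ^ 5)⁻¹ * ℓ /
          ((1 + ε) ^ (2 * B) * ((1 + ε) * ((1 + 3 / 2 * ε) / (1 - 3 / 2 * ε)))) *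
          ((3 / 2 * ε) ^ 2 / (2 + 3 / 2 * ε)) := by
        field_simp
        ring
    _ ≤ _ := by
        have ht0 : 0 ≤ t := le_trans (by positivity) ht
        gcongr

theorem two_mul_le_exp {w : ℝ} (hw : 64 ≤ w) : 2 * w ≤ Real.exp ((w / 3 - 12) * Real.log 2) := by
  have h2 := Real.log_two_gt_d9
  have e : (w / 3 - 12) * Real.log 2 = (9 : ℕ) * Real.log 2 + (w - 63) / 3 * Real.log 2 := by
    push_cast; ring
  -- The first factor is `2 ^ 9 = 512`, and the second one is bounded from below by its tangent.
  rw [e, Real.exp_add, ← Real.log_pow, Real.exp_log (by norm_num)]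
  have h3 := Real.add_one_le_exp ((w - 63) / 3 * Real.log 2)
  nlinarith

theorem rounds_le (hε : 0 < ε) (hε' : ε ≤ 1 / 4) {N n : ℝ} (hN : 1 ≤ N) (hNn : N ≤ n)
    (hn : 2 ≤ n) : 2 * Real.log (2 * N / ε) / ε ^ 2 + 1 / ε ≤ n * (1 / ε) ^ 3 := by
  set z := 1 / ε with hz
  have hz4 : 4 ≤ z := by rw [hz, le_div_iff₀ hε]; linarith
  -- By the tangents of the logarithm at `n = 2` and at `z = 2`.
  have hlog : Real.log (2 * N / ε) ≤ 0.08 + n / 2 + z / 2 := by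
    have h1 : Real.log (2 * N / ε) ≤ Real.log (2 ^ 3 * (n / 2) * (z / 2)) := by
      refine Real.log_le_log (by positivity) ?_
      have : 2 ^ 3 * (n / 2) * (z / 2) = 2 * n / ε := by rw [hz]; field_simp
      rw [this]
      gcongr
    rw [Real.log_mul (by positivity) (by positivity), Real.log_mul (by positivity) (by positivity),
      Real.log_pow] at h1
    have h2 := Real.log_le_sub_one_of_pos (show 0 < n / 2 by positivity)
    have h3 := Real.log_le_sub_one_of_pos (show 0 < z / 2 by positivity)
    have h4 := Real.log_two_lt_d9
    push_cast at h1
    linarith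
  have hnz : 8 ≤ n * z := by nlinarith
  have h5 : Real.log (2 * N / ε) ≤ 0.385 * (n * z) := by nlinarith
  have h6 : 2 * Real.log (2 * N / ε) / ε ^ 2 = 2 * Real.log (2 * N / ε) * z ^ 2 := by
    rw [hz]; field_simp
  rw [h6]
  have h7 : 2 * Real.log (2 * N / ε) * z ^ 2 ≤ 2 * (0.385 * (n * z)) * z ^ 2 := by gcongr
  have h8 : z ≤ n * z ^ 3 * (1 / 32) := by
    have : 32 ≤ n * z ^ 2 := by nlinarith
    nlinarith
  have h9 : 0 ≤ n * z ^ 3 := by positivity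
  nlinarith

/-- The failure probability of a round is at most `n⁻¹⁰ / τ₀`. -/
theorem round_failure_le (hε : 0 < ε) (hε' : ε ≤ 1 / 4) {N : ℝ} {n : ℕ} (hN : 1 ≤ N)
    (hNn : N ≤ n) (hn : 2 ≤ n) :
    n * (2 * Real.exp (-(Real.log n / (3 * ε ^ 3)))) *
      (2 * Real.log (2 * N / ε) / ε ^ 2 + 1 / ε) ≤ ((n : ℝ) ^ 10)⁻¹ := by
  have hn' : (2 : ℝ) ≤ n := by exact_mod_cast hn
  have hn0 : (0 : ℝ) < n := by linarith
  set w := (1 / ε) ^ 3 with hw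
  have hw64 : 64 ≤ w := by
    have : 4 ≤ 1 / ε := by rw [le_div_iff₀ hε]; linarith
    calc (64 : ℝ) = 4 ^ 3 := by norm_num
      _ ≤ _ := by rw [hw]; gcongr
  have h1 := rounds_le hε hε' hN hNn hn'
  have h2 : Real.log n / (3 * ε ^ 3) = w / 3 * Real.log n := by rw [hw]; field_simp
  have h3 : 2 * w ≤ Real.exp ((w / 3 - 12) * Real.log n) :=
    (two_mul_le_exp hw64).trans (by
      gcongr
      linarith)
  have h4 : Real.exp (12 * Real.log n) = (n : ℝ) ^ 12 := by
    rw [show (12 : ℝ) * Real.log n = (12 : ℕ) * Real.log n by push_cast; ring, ← Real.log_pow,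
      Real.exp_log (by positivity)]
  rw [h2]
  calc n * (2 * Real.exp (-(w / 3 * Real.log n))) *
        (2 * Real.log (2 * N / ε) / ε ^ 2 + 1 / ε)
      ≤ n * (2 * Real.exp (-(w / 3 * Real.log n))) * (n * w) := by gcongr
    _ = 2 * w * n ^ 2 * Real.exp (-(w / 3 * Real.log n)) := by ring
    _ ≤ Real.exp ((w / 3 - 12) * Real.log n) * n ^ 2 * Real.exp (-(w / 3 * Real.log n)) := by
        gcongr
    _ = Real.exp (-(12 * Real.log n)) * n ^ 2 := by
        rw [mul_right_comm, ← Real.exp_add]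
        congr 2
        ring
    _ = ((n : ℝ) ^ 10)⁻¹ := by
        rw [Real.exp_neg, h4]; field_simp

end Numerics

/-! ### The failure probability of the algorithm -/

/-- Union bound for two consecutive random steps: the first one ends in `bad`, or the second one fails
from a state outside `bad`. -/
theorem toOuterMeasure_bind_le {α γ : Type*} (p : PMF α) (f : α → PMF γ) (A : Set γ) (bad : Set α)
    (q : ENNReal) (h : ∀ a, a ∉ bad → (f a).toOuterMeasure A ≤ q) :
    (p.bind f).toOuterMeasure A ≤ p.toOuterMeasure bad + q := by
  rw [PMF.toOuterMeasure_bind_apply, PMF.toOuterMeasure_apply]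
  calc ∑' a, p a * (f a).toOuterMeasure A ≤ ∑' a, (bad.indicator p a + p a * q) := by
        refine ENNReal.tsum_le_tsum fun a => ?_
        by_cases ha : a ∈ bad
        · rw [Set.indicator_of_mem ha]
          refine le_add_right ?_
          calc p a * (f a).toOuterMeasure A ≤ p a * 1 := by
                gcongr
                exact ((f a).toOuterMeasure.mono (Set.subset_univ A)).trans
                  (((f a).toOuterMeasure_apply_eq_one_iff _).2 (Set.subset_univ _)).le
            _ = p a := mul_one _
        · rw [Set.indicator_of_notMem ha, zero_add]
          gcongr
          exact h a ha
    _ = _ := by rw [ENNReal.tsum_add, ENNReal.tsum_mul_right, p.tsum_coe, one_mul]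

variable {V : Type*} [Fintype V] {I : AllocationInstance V}

theorem drawSamples_toOuterMeasure_le {ε : ℝ} {τ t : ℕ} {g : V → ℝ} (A : Samples V τ t → Prop)
    [DecidablePred A] {q : ℝ} (h : (#((I.outcomes ε τ t g).filter A) : ℝ) ≤ q * #(I.outcomes ε τ t g)) :
    (I.drawSamples ε τ t g).toOuterMeasure {s | A s} ≤ ENNReal.ofReal q := by
  have hne : (I.outcomes ε τ t g).Nonempty :=
    Fintype.piFinset_nonempty.2 fun k => I.sampleSet_nonempty ε g k.1 k.2.1
  have hpos : (0 : ℝ) < #(I.outcomes ε τ t g) := by exact_mod_cast hne.card_pos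
  rw [drawSamples, PMF.toOuterMeasure_uniformOfFinset_apply]
  rw [← div_le_iff₀ hpos] at h
  refine le_trans (le_of_eq ?_) (ENNReal.ofReal_le_ofReal h)
  rw [ENNReal.ofReal_div_of_pos hpos, ENNReal.ofReal_natCast, ENNReal.ofReal_natCast]
  simp only [Set.mem_ofPred_eq]

/-- A round destroys the invariant with probability at most `2 n ^ (1 - 1 / (3 ε³))`. -/
theorem Good.round_toOuterMeasure_le {ε : ℝ} (hε : 0 < ε) (hε' : ε ≤ 1 / 4) {B τ r : ℕ} (hB : 1 ≤ B)
    (hR : I.R.Nonempty) (hn : 2 ≤ Fintype.card V) (hτ : I.roundBound ε ≤ τ) (hr : r < τ)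
    {S : State V} (hS : I.Good ε (3 / 2 * ε) B r S) :
    (I.round ε B τ (numSamples V ε B) r S).toOuterMeasure
        {S' | ¬ I.Good ε (3 / 2 * ε) B (r + 1) S'} ≤
      ENNReal.ofReal (Fintype.card V *
        (2 * Real.exp (-(Real.log (Fintype.card V) / (3 * ε ^ 3))))) := by
  have hδ : 0 ≤ 3 / 2 * ε := by positivity
  have hδ1 : 3 / 2 * ε < 1 := by linarith
  have hN : (1 : ℝ) ≤ #I.R := by exact_mod_cast hR.card_pos
  have hlogn : 0 < Real.log (Fintype.card V) :=
    Real.log_pos (by exact_mod_cast (by omega : 1 < Fintype.card V))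
  have ht : 0 < numSamples V ε B := Nat.ceil_pos.2 (by positivity)
  have hpow : 8 * (#I.R : ℝ) ≤ (1 + ε) ^ τ := by
    refine le_trans ?_ (div_le_one_add_pow_rounds hε hε' hN hτ)
    rw [le_div_iff₀ hε]
    nlinarith
  obtain ⟨b, c, hb, hc, hbc⟩ := id hS
  have hβ : ∀ v ∈ I.R, 0 < S.β v := fun v hv => hb.pos hε hv
  have hcov := hc.covers hε hr hδ (by nlinarith) (by nlinarith)
  have hnear := near_of_exponents hε hc.eq_zpow hb.eq_zpow hbc
  have hcard := card_not_accurate_le hc hβ hε hδ hδ1 hnear ht hcov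
  have hexp := le_chernoff_exponent hε hε' hlogn.le (Nat.mod_lt r hB)
    (Nat.le_ceil ((1 + ε) ^ (2 * B) * (ε ^ 5)⁻¹ * Real.log (Fintype.card V)))
  have hdraw := drawSamples_toOuterMeasure_le
    (fun s => ¬ I.Accurate ε (3 / 2 * ε) τ (numSamples V ε B) (groupPriority B r S) S.β s) hcard
  rw [AllocationInstance.round, PMF.toOuterMeasure_map_apply]
  refine (MeasureTheory.measure_mono fun s hs => ?_).trans
    (hdraw.trans (ENNReal.ofReal_le_ofReal ?_))
  · intro hacc
    exact hs (hS.step hε hδ hδ1 hacc _)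
  · refine mul_le_mul_of_nonneg_left ?_ (Nat.cast_nonneg _)
    exact mul_le_mul_of_nonneg_left (Real.exp_le_exp.2 (neg_le_neg hexp)) zero_le_two

theorem run_toOuterMeasure_le {ε : ℝ} (hε : 0 < ε) (hε' : ε ≤ 1 / 4) {B τ : ℕ} (hB : 1 ≤ B)
    (hR : I.R.Nonempty) (hn : 2 ≤ Fintype.card V) (hτ : I.roundBound ε ≤ τ) {r : ℕ} (hr : r ≤ τ) :
    (I.run ε B τ (numSamples V ε B) r).toOuterMeasure {S | ¬ I.Good ε (3 / 2 * ε) B r S} ≤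
      r * ENNReal.ofReal (Fintype.card V *
        (2 * Real.exp (-(Real.log (Fintype.card V) / (3 * ε ^ 3))))) := by
  induction r with
  | zero =>
    have : I.initState ∉ {S | ¬ I.Good ε (3 / 2 * ε) B 0 S} :=
      not_not.2 (good_initState hε (by positivity) B)
    rw [run, PMF.toOuterMeasure_pure_apply, if_neg this]
    exact zero_le
  | succ r ih =>
    rw [run, Nat.cast_succ, add_mul, one_mul]
    refine (toOuterMeasure_bind_le _ _ _ {S | ¬ I.Good ε (3 / 2 * ε) B r S} _ fun S hS => ?_).trans
      (add_le_add_left (ih (by omega)) _)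
    exact Good.round_toOuterMeasure_le hε hε' hB hR hn hτ hr (not_not.1 hS)

theorem Good.isApprox {ε : ℝ} (hε : 0 < ε) (hε' : ε ≤ 1 / 4) {B r : ℕ} (hR : I.R.Nonempty)
    (hr : I.roundBound ε ≤ (r + 1 : ℕ)) {S : State V} (hS : I.Good ε (3 / 2 * ε) B r S) :
    I.IsApproxFractionalAllocation (1 + 18 * ε) (I.rescaled S.β) := by
  obtain ⟨b, c, hb, -, -⟩ := hS
  have hβ : ∀ v ∈ I.R, 0 < S.β v := fun v hv => hb.pos hε hv
  have hN : (1 : ℝ) ≤ #I.R := by exact_mod_cast hR.card_pos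
  obtain ⟨K, m, hK, hKε, hm, hKm⟩ := exists_windows hε hε' hN hr
  have hκ : 1 ≤ slack ε (3 / 2 * ε) := by
    have : 1 ≤ (1 + 3 / 2 * ε) / (1 - 3 / 2 * ε) := by
      rw [one_le_div (by linarith)]; linarith
    unfold slack
    nlinarith [sq_nonneg ε]
  obtain ⟨h1, h2⟩ := hb.isApprox hε hκ (by positivity) (by linarith) hm hK hKm
  refine ⟨h1, fun y hy => (h2 y hy).trans ?_⟩
  have hW : 0 ≤ I.weight (I.rescaled S.β) := by
    rw [weight_rescaled hβ]
    exact sum_nonneg fun v hv => le_min (alloc_nonneg hβ hv) (Nat.cast_nonneg _)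
  exact mul_le_mul_of_nonneg_right (slack_div_mul_le hε hε' hKε) hW

theorem isApprox_of_no_edges (h : ∀ w, I.N w = ∅) (a : ℝ) (x : V → V → ℝ) :
    I.IsApproxFractionalAllocation a x := by
  simp [IsApproxFractionalAllocation, IsFractionalAllocation, weight, h]

end AllocationInstance

open AllocationInstance in
theorem mainTheorem9 {V : Type*} [Fintype V] (I : AllocationInstance V)
    (ε : ℝ) (hε : 0 < ε) (hε' : ε ≤ 1 / 4) (B : ℕ) (hB : 1 ≤ B)
    (τ : ℕ) (hτ : I.roundBound ε ≤ (τ : ℝ)) :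
    (I.sampledAllocation ε B τ).toOuterMeasure
        {x | ¬ I.IsApproxFractionalAllocation (1 + 18 * ε) x} ≤
      ENNReal.ofReal ((τ : ℝ) / I.roundBound ε * ((Fintype.card V : ℝ) ^ 10)⁻¹) := by
  by_cases hE : ∀ w, I.N w = ∅
  · have : {x | ¬ I.IsApproxFractionalAllocation (1 + 18 * ε) x} = ∅ := by
      ext x
      simpa using isApprox_of_no_edges hE _ x
    rw [this, MeasureTheory.measure_empty]
    exact zero_le
  push Not at hE
  obtain ⟨w, a, ha⟩ := hE
  have hn : 2 ≤ Fintype.card V :=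
    Fintype.one_lt_card_iff.2 ⟨w, a, (I.mem_N.1 ha).ne⟩
  have hR : I.R.Nonempty := by
    rcases I.cover w with h | h
    · exact ⟨a, I.mem_R_of_mem_N h ha⟩
    · exact ⟨w, h⟩
  have hN : (1 : ℝ) ≤ I.R.card := by exact_mod_cast hR.card_pos
  have hNn : (I.R.card : ℝ) ≤ Fintype.card V := by exact_mod_cast Finset.card_le_univ _
  have hΛ := log_two_mul_div_nonneg hε hε' hN
  have hτ0 : 0 < I.roundBound ε := by unfold roundBound; positivity
  obtain ⟨r, rfl⟩ : ∃ r, τ = r + 1 := by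
    refine Nat.exists_eq_succ_of_ne_zero ?_
    rintro rfl
    rw [Nat.cast_zero] at hτ
    linarith
  rw [sampledAllocation, PMF.toOuterMeasure_map_apply, run]
  -- The output only depends on the first `τ - 1` rounds.
  refine (toOuterMeasure_bind_le _ _ _ {S | ¬ I.Good ε (3 / 2 * ε) B r S} 0 fun S hS => ?_).trans ?_
  · rw [AllocationInstance.round, PMF.toOuterMeasure_map_apply]
    refine le_of_eq ?_
    rw [← MeasureTheory.measure_empty (μ := (I.drawSamples ε (r + 1) (numSamples V ε B)
      (groupPriority B r S)).toOuterMeasure)]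
    congr 1
    ext s
    simpa using Good.isApprox hε hε' hR hτ (not_not.1 hS)
  · rw [add_zero]
    refine (run_toOuterMeasure_le hε hε' hB hR hn hτ (Nat.le_succ r)).trans ?_
    rw [← ENNReal.ofReal_natCast, ← ENNReal.ofReal_mul (Nat.cast_nonneg _)]
    refine ENNReal.ofReal_le_ofReal ?_
    have hq := round_failure_le hε hε' hN hNn hn
    change _ * I.roundBound ε ≤ _ at hq
    rw [← le_div_iff₀ hτ0] at hq
    calc (r : ℝ) * _ ≤ ((r + 1 : ℕ) : ℝ) *
          (((Fintype.card V : ℝ) ^ 10)⁻¹ / I.roundBound ε) := by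
          gcongr
          omega
      _ = _ := by ring
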